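/- \textbf{Setting.} Let $d\ge 1$, let $\mathbb H$ be a separable complex Hilbert space with a fixed complete orthonormal system $\{e_j\}$, and let $\overline{x}=\sum_j\overline{\langle x,e_j\rangle}e_j$. Write $[x\otimes y](z)=\langle z,y\rangle x$, $\|A\|_{\rm tr}=\sum_j\langle (A^*A)^{1/2}e_j,e_j\rangle$, $\langle A,B\rangle_{\rm HS}={\rm trace}(A^*B)$, $\|A\|_{\rm HS}=\|A^*A\|_{\rm tr}^{1/2}$. Let $X=\{X(t),t\in\mathbb R^d\}$ be an $\mathbb H$-valued process that is real ($\overline{X(t)}=X(t)$ a.s.), has mean zero and finite second moments, and is second-order stationary, i.e. $\mathbb E[X(t)\otimes X(s)]$ and $\mathbb E[X(t)\otimes\overline{X(s)}]$ depend only on $t-s$. Let $C(h)=\mathbb E[X(h)\otimes X(0)]$. Let $B(0,\epsilon)$ be the open Euclidean ball. (C) $C$ is measurable, $\int\|C(h)\|_{\rm tr}\,dh<\infty$, and for some $0<\gamma\le1$ and $M<\infty$, $\int \sup_{\|y-x\|\le\delta}\|C(y)-C(x)\|_{\rm tr}\,dx\le M\delta^\gamma$ for all $\delta\in(0,1)$.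 Let $f(\theta)=(2\pi)^{-d}\int e^{\mathrm i h^\top\theta}C(h)\,dh$ be the spectral density. (V) $\mathbb E\|X(t)\|^4<\infty$ for all $t$. With ${\rm cum}(Y_1,Y_2,Y_3,Y_4)=\mathbb E\langle Y_1\otimes Y_2,Y_3\otimes Y_4\rangle_{\rm HS}-\langle\mathbb E[Y_1\otimes Y_2],\mathbb E[Y_3\otimes Y_4]\rangle_{\rm HS}-\mathbb E\langle Y_1,Y_3\rangle\,\mathbb E\langle Y_4,Y_2\rangle-\langle\mathbb E[Y_1\otimes\overline{Y_4}],\mathbb E[Y_3\otimes\overline{Y_2}]\rangle_{\rm HS}$, the quantity ${\rm cum}(X(t+\tau),X(s+\tau),X(w+\tau),X(v+\tau))$ does not depend on $\tau$, and for some $\epsilon>0$ $$\sup_w\int\!\!\int\sup_{\lambda_1,\lambda_2,\lambda_3\in B(0,\epsilon)}|{\rm cum}(X(\lambda_1+u),X(\lambda_2+v),X(\lambda_3+w),X(0))|\,dv\,du<\infty.$$ (K) $K:\mathbb R^d\to[0,\infty)$ is continuous, $S_K=\{K>0\}$ is bounded and contains $0$, $\sup K=K(0)=1$, and $K$ is differentiable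 with bounded gradient in a neighbourhood of $0$. (S) The data are observed on the grids $\mathbb T_n=\prod_{\ell=1}^d\{\delta_n,2\delta_n,\dots,n_\ell\delta_n\}$, where $\delta_n>0$ and $n_\ell=n_\ell(n)$. The sampling region $T_n$ is (for all $n$) the closed convex hull of $\mathbb T_n$, or (for all $n$) the box $\prod_\ell[0,n_\ell\delta_n]$. One has $\delta_n\to0$, $|T_n|\to\infty$ (Lebesgue measure), and $|T_n|^{-1/d}T_n$ converges in the Hausdorff metric to a bounded convex set with non-empty interior. For a bandwidth $\Delta_n>0$ the estimator is $$\hat f_n(\theta)=\frac{\delta_n^{2d}}{(2\pi)^d}\sum_{t\in\mathbb T_n}\sum_{s\in\mathbb T_n}e^{\mathrm i(t-s)^\top\theta}\,\frac{X(t)\otimes X(s)}{|T_n\cap(T_n-(t-s))|}\,K\Big(\frac{t-s}{\Delta_n}\Big).$$ \textbf{Theorem.} Assume (C), (V), (K), (S). Let $\beta,L>0$ and suppose that $f$ belongs to the class $\mathcal P_C(\beta,L)$ of all functions $\theta\mapsto(2\pi)^{-d}\int e^{\mathrm i x^\top\theta}C'(x)\,dx$ with $\int(1+\|x\|^\beta)\|C'(x)\|_{\rm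 tr}\,dx\le L$. Suppose that, for some integer $\lambda>0\vee(\beta-1)$, the partial derivatives of $K$ of all orders up to $\lambda+1$ exist on $\mathbb R^d$, those of orders $1,\dots,\lambda$ vanish at $0$, and those of order $\lambda+1$ are bounded. Let $\Theta\subset\mathbb R^d$ be bounded. (i) If $\Delta_n\to\infty$, $\Delta_n^d/|T_n|\to0$ and $\Delta_n\cdot S_K\subset T_n-T_n$ for all sufficiently large $n$, then $$\sup_{\theta\in\Theta}\|\mathbb E\hat f_n(\theta)-f(\theta)\|_{\rm HS}=\mathcal O\big(\delta_n^\gamma+\Delta_n^{-\beta}\big),\qquad n\to\infty.$$ (ii) If $\Delta_n=|T_n|^{1/(2\beta+d)}$, then $$\sup_{\theta\in\Theta}\big(\mathbb E\|\hat f_n(\theta)-f(\theta)\|_{\rm HS}^2\big)^{1/2}=\mathcal O\big(\delta_n^\gamma\vee|T_n|^{-\beta/(2\beta+d)}\big),\qquad n\to\infty.$$ The constants in $\mathcal O(\cdot)$ may depend on the process $X$; no uniformity over $\mathcal P_C(\beta,L)$ is claimed. -/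

import Mathlib

open MeasureTheory Filter Topology
open scoped ENNReal InnerProductSpace Pointwise InnerProduct

noncomputable section

/-- The parameter space `ℝᵈ` with its Euclidean norm. -/
abbrev Pt (d : ℕ) := EuclideanSpace ℝ (Fin d)

section Operators

variable {H : Type*} [NormedAddCommGroup H] [InnerProductSpace ℂ H] [CompleteSpace H]
  {ι : Type*}

/-- Complex conjugation on `H` with respect to the designated real orthonormal basis `e`:
`∑ ⟨x, e_j⟩ e_j ↦ ∑ conj ⟨x, e_j⟩ e_j`. -/
def conjVec (e : HilbertBasis ι ℂ H) (x : H) : H := e.repr.symm (star (e.repr x))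

/-- The trace norm `∑_j ⟨(A* A)^{1/2} e_j, e_j⟩ ∈ [0, ∞]`. -/
def traceNorm (e : HilbertBasis ι ℂ H) (A : H →L[ℂ] H) : ℝ≥0∞ :=
  ∑' j, ENNReal.ofReal (RCLike.re ⟪CFC.sqrt (star A * A) (e j), e j⟫_ℂ)

/-- The Hilbert-Schmidt norm `‖A* A‖_tr^{1/2} ∈ [0, ∞]`. -/
def hsNorm (e : HilbertBasis ι ℂ H) (A : H →L[ℂ] H) : ℝ≥0∞ :=
  traceNorm e (star A * A) ^ (1 / 2 : ℝ)

/-- The Hilbert-Schmidt inner product `trace (A* B)`. -/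
def hsInner (e : HilbertBasis ι ℂ H) (A B : H →L[ℂ] H) : ℂ :=
  ∑' j, ⟪e j, (star A * B) (e j)⟫_ℂ

end Operators

section Processes

variable {H : Type*} [NormedAddCommGroup H] [InnerProductSpace ℂ H] [CompleteSpace H]
  {ι Ω : Type*} [MeasurableSpace Ω] {d : ℕ}

/-- `𝔼[Y ⊗ Z]`, where `(x ⊗ y) z = ⟨z, y⟩ x`. -/
def crossCov (P : Measure Ω) (Y Z : Ω → H) : H →L[ℂ] H :=
  ∫ ω, InnerProductSpace.rankOne ℂ (Y ω) (Z ω) ∂P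

/-- The fourth-order cumulant of `H`-valued random elements with mean zero. -/
def cum4 (e : HilbertBasis ι ℂ H) (P : Measure Ω) (Y₁ Y₂ Y₃ Y₄ : Ω → H) : ℂ :=
  (∫ ω, hsInner e (InnerProductSpace.rankOne ℂ (Y₁ ω) (Y₂ ω))
      (InnerProductSpace.rankOne ℂ (Y₃ ω) (Y₄ ω)) ∂P)
    - hsInner e (crossCov P Y₁ Y₂) (crossCov P Y₃ Y₄)
    - (∫ ω, ⟪Y₁ ω, Y₃ ω⟫_ℂ ∂P) * (∫ ω, ⟪Y₄ ω, Y₂ ω⟫_ℂ ∂P)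
    - hsInner e (crossCov P Y₁ (fun ω => conjVec e (Y₄ ω)))
        (crossCov P Y₃ (fun ω => conjVec e (Y₂ ω)))

/-- `X` is a zero-mean, second-order, covariance stationary process on `ℝᵈ`, real with respect
to the orthonormal basis `e`. -/
structure IsStationaryRealProcess (e : HilbertBasis ι ℂ H) (P : Measure Ω)
    (X : Pt d → Ω → H) : Prop where
  memLp_two : ∀ t, MemLp (X t) 2 P
  mean_zero : ∀ t, ∫ ω, X t ω ∂P = 0
  real : ∀ t, ∀ᵐ ω ∂P, conjVec e (X t ω) = X t ω
  cov_shift : ∀ t s τ, crossCov P (X (t + τ)) (X (s + τ)) = crossCov P (X t) (X s)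
  pseudoCov_shift : ∀ t s τ,
    crossCov P (X (t + τ)) (fun ω => conjVec e (X (s + τ) ω))
      = crossCov P (X t) (fun ω => conjVec e (X s ω))

/-- The stationary covariance operator `C(h) = 𝔼[X(h) ⊗ X(0)]`. -/
def covOp (P : Measure Ω) (X : Pt d → Ω → H) (h : Pt d) : H →L[ℂ] H :=
  crossCov P (X h) (X 0)

/-- `(2π)^{-d} ∫ e^{i xᵀθ} C(x) dx`, a Bochner integral. -/
def fourierOp (C : Pt d → H →L[ℂ] H) (θ : Pt d) : H →L[ℂ] H :=
  ((((2 * Real.pi) ^ d)⁻¹ : ℝ) : ℂ) •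
    ∫ x : Pt d, Complex.exp (Complex.I * ((⟪x, θ⟫_ℝ : ℝ) : ℂ)) • C x

/-- The spectral density of `X`. -/
def spectralDensity (P : Measure Ω) (X : Pt d → Ω → H) : Pt d → H →L[ℂ] H :=
  fourierOp (covOp P X)

/-- The continuous-parameter power law class `P_C(β, L)`: all
`f(θ) = (2π)^{-d} ∫ e^{i xᵀθ} C(x) dx` with `∫ (1 + ‖x‖^β) ‖C(x)‖_tr dx ≤ L`. -/
def powerLawClass (e : HilbertBasis ι ℂ H) (d : ℕ) (β L : ℝ) : Set (Pt d → H →L[ℂ] H) :=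
  {f | ∃ C : Pt d → H →L[ℂ] H, AEStronglyMeasurable C volume ∧
    ∫⁻ x, ENNReal.ofReal (1 + ‖x‖ ^ β) * traceNorm e (C x) ≤ ENNReal.ofReal L ∧
    ∀ θ, f θ = fourierOp C θ}

/-- The covariance function is integrable in trace norm and `L¹`-`γ`-Hölder. -/
structure CovAssumption (e : HilbertBasis ι ℂ H) (γ : ℝ) (C : Pt d → H →L[ℂ] H) : Prop where
  gamma_pos : 0 < γ
  gamma_le_one : γ ≤ 1
  measurable : AEStronglyMeasurable C volume
  integrable : ∫⁻ h, traceNorm e (C h) < ∞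
  holder : ∃ M : ℝ, ∀ δ : ℝ, 0 < δ → δ < 1 →
    ∫⁻ x, (⨆ y ∈ Metric.closedBall x δ, traceNorm e (C y - C x)) ≤ ENNReal.ofReal (M * δ ^ γ)

/-- Fourth moments, fourth-order cumulant stationarity and cumulant integrability. -/
structure CumulantAssumption (e : HilbertBasis ι ℂ H) (P : Measure Ω)
    (X : Pt d → Ω → H) : Prop where
  memLp_four : ∀ t, MemLp (X t) 4 P
  cum_shift : ∀ t s w v τ,
    cum4 e P (X (t + τ)) (X (s + τ)) (X (w + τ)) (X (v + τ)) = cum4 e P (X t) (X s) (X w) (X v)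
  cum_integrable : ∃ δ : ℝ, 0 < δ ∧
    (⨆ w : Pt d, ∫⁻ u : Pt d, ∫⁻ v : Pt d,
      ⨆ l₁ ∈ Metric.ball (0 : Pt d) δ, ⨆ l₂ ∈ Metric.ball (0 : Pt d) δ,
        ⨆ l₃ ∈ Metric.ball (0 : Pt d) δ,
          ‖cum4 e P (X (l₁ + u)) (X (l₂ + v)) (X (l₃ + w)) (X 0)‖ₑ) < ∞

end Processes

section Kernels

variable {d : ℕ}

/-- `S_K = {t : K(t) > 0}`. -/
def kernelSupport (K : Pt d → ℝ) : Set (Pt d) := {t | 0 < K t}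

/-- The standard conditions on the kernel. -/
structure KernelAssumption (K : Pt d → ℝ) : Prop where
  continuous : Continuous K
  nonneg : ∀ t, 0 ≤ K t
  bounded_support : Bornology.IsBounded (kernelSupport K)
  zero_mem_support : (0 : Pt d) ∈ kernelSupport K
  at_zero : K 0 = 1
  le_one : ∀ t, K t ≤ 1
  grad : ∃ ε : ℝ, 0 < ε ∧ (∀ u ∈ Metric.ball (0 : Pt d) ε, DifferentiableAt ℝ K u) ∧
    ∃ M : ℝ, ∀ u ∈ Metric.ball (0 : Pt d) ε, ‖gradient K u‖ ≤ M

/-- Iterated partial derivatives of `K`: `iterPartial K [i₁, …, i_m] = ∂_{i₁} ⋯ ∂_{i_m} K`. -/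
def iterPartial (K : Pt d → ℝ) : List (Fin d) → Pt d → ℝ
  | [] => K
  | i :: l => fun x => lineDeriv ℝ (iterPartial K l) x (EuclideanSpace.single i 1)

/-- All partial derivatives of `K` of order at most `lam + 1` exist everywhere, those of orders
`1, …, lam` vanish at the origin, and those of order `lam + 1` are bounded. -/
structure KernelFlat (K : Pt d → ℝ) (lam : ℕ) : Prop where
  exists_partial : ∀ l : List (Fin d), l.length ≤ lam → ∀ (i : Fin d) (x : Pt d),
    LineDifferentiableAt ℝ (iterPartial K l) x (EuclideanSpace.single i 1)
  vanish : ∀ l : List (Fin d), 1 ≤ l.length → l.length ≤ lam → iterPartial K l 0 = 0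
  bounded : ∀ l : List (Fin d), l.length = lam + 1 → ∃ M : ℝ, ∀ x, |iterPartial K l x| ≤ M

end Kernels

section Sampling

variable {d : ℕ}

open Classical in
/-- The grid `{δ, …, N₁ δ} × ⋯ × {δ, …, N_d δ}`. -/
def gridPoints (δ : ℝ) (N : Fin d → ℕ) : Finset (Pt d) :=
  (Fintype.piFinset fun l => Finset.Icc 1 (N l)).image
    fun k => WithLp.toLp 2 fun l => (k l : ℝ) * δ

/-- The closed convex hull of the grid. -/
def gridHull (δ : ℝ) (N : Fin d → ℕ) : Set (Pt d) :=
  closedConvexHull ℝ (gridPoints δ N : Set (Pt d))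

/-- The box `[0, N₁ δ] × ⋯ × [0, N_d δ]`, the union of the grid cells. -/
def gridBox (δ : ℝ) (N : Fin d → ℕ) : Set (Pt d) :=
  {x | ∀ l, 0 ≤ x l ∧ x l ≤ (N l : ℝ) * δ}

/-- Mixed-domain asymptotics for the grid size `δ n` and sampling region `T n`. -/
structure SamplingAssumption (δ : ℕ → ℝ) (T : ℕ → Set (Pt d)) : Prop where
  delta_pos : ∀ n, 0 < δ n
  delta_tendsto : Tendsto δ atTop (𝓝 0)
  volume_tendsto : Tendsto (fun n => volume.real (T n)) atTop atTop
  shape : ∃ T₀ : Set (Pt d), Bornology.IsBounded T₀ ∧ Convex ℝ T₀ ∧ (interior T₀).Nonempty ∧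
    Tendsto (fun n => Metric.hausdorffEDist
      ((volume.real (T n) ^ (-(1 / (d : ℝ)))) • T n) T₀) atTop (𝓝 0)

end Sampling

section Estimator

variable {H : Type*} [NormedAddCommGroup H] [InnerProductSpace ℂ H] [CompleteSpace H]
  {Ω : Type*} {d : ℕ}

/-- The spectral density estimator for gridded data with grid size `δ`, grid dimensions `N`,
sampling region `T` and bandwidth `Δ`. -/
def specEstimator (K : Pt d → ℝ) (X : Pt d → Ω → H) (δ : ℝ) (N : Fin d → ℕ) (T : Set (Pt d))
    (Δ : ℝ) (θ : Pt d) (ω : Ω) : H →L[ℂ] H :=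
  ((δ ^ (2 * d) / (2 * Real.pi) ^ d : ℝ) : ℂ) •
    ∑ t ∈ gridPoints δ N, ∑ s ∈ gridPoints δ N,
      (Complex.exp (Complex.I * ((⟪t - s, θ⟫_ℝ : ℝ) : ℂ)) *
        ((K (Δ⁻¹ • (t - s)) / volume.real (T ∩ (fun x => x - (t - s)) '' T) : ℝ) : ℂ)) •
          InnerProductSpace.rankOne ℂ (X t ω) (X s ω)

end Estimator

end

/-!
The bias splits into three parts. At lag `m` the estimator weighs the covariance by the number of
pairs of observations at that lag over the volume of the overlap of the region with its translate,
and this ratio is `1 + O(δ)`; the remaining sum over the lattice is the integral of a step function,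
so it differs from the Fourier integral by `O(δ ^ γ)` through the `L¹` modulus of continuity of the
covariance; and the kernel is `1 + O(‖x‖ ^ β)` because its Taylor polynomial at the origin is
constant. The last error is controlled by the `β`-th moment of the covariance, which a member of the
power law class inherits from its representing function by uniqueness of Fourier transforms.

For the variance, the covariance of two dyads `X(t) ⊗ X(s)` is a fourth-order cumulant plus two
products of second-order covariances. By stationarity, three of the four lattice sums are bounded
by integrals of the cumulant, of the covariance, or of the indicator of the lags kept by the
kernel, and the fourth counts the observations; this gives `O(Δ ^ d / |T|)`.
-/

/-! ### Hilbert–Schmidt and trace norms -/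

section HilbertSchmidt

theorem enorm_inner_le {E : Type*} [NormedAddCommGroup E] [InnerProductSpace ℂ E] (x y : E) :
    ‖⟪x, y⟫_ℂ‖ₑ ≤ ‖x‖ₑ * ‖y‖ₑ := by
  simp only [enorm_eq_nnnorm]
  exact_mod_cast nnnorm_inner_le_nnnorm (𝕜 := ℂ) x y

theorem enorm_sq_eq_ofReal {E : Type*} [NormedAddCommGroup E] (x : E) :
    ‖x‖ₑ ^ 2 = ENNReal.ofReal (‖x‖ ^ 2) := by
  rw [ENNReal.ofReal_pow (norm_nonneg x), ofReal_norm]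

theorem tsum_mul_le_rpow_tsum_sq {ι : Type*} (f g : ι → ℝ≥0∞) :
    ∑' j, f j * g j ≤ (∑' j, f j ^ 2) ^ (1 / 2 : ℝ) * (∑' j, g j ^ 2) ^ (1 / 2 : ℝ) := by
  rw [ENNReal.tsum_eq_iSup_sum]
  refine iSup_le fun J => ?_
  have finite_section := ENNReal.inner_le_Lp_mul_Lq J f g Real.HolderConjugate.two_two
  simp only [ENNReal.rpow_ofNat] at finite_section
  refine finite_section.trans ?_
  gcongr <;> exact ENNReal.sum_le_tsum J

variable {H : Type*} [NormedAddCommGroup H] [InnerProductSpace ℂ H] {ι : Type*}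

theorem enorm_hilbertBasis (e : HilbertBasis ι ℂ H) (j : ι) : ‖e j‖ₑ = 1 := by
  rw [← ofReal_norm, e.orthonormal.1 j, ENNReal.ofReal_one]

theorem tsum_enorm_inner_sq (e : HilbertBasis ι ℂ H) (x : H) :
    ∑' j, ‖⟪e j, x⟫_ℂ‖ₑ ^ 2 = ‖x‖ₑ ^ 2 := by
  have parseval : HasSum (fun j => ‖⟪e j, x⟫_ℂ‖ ^ 2) (‖x‖ ^ 2) := by
    have h := e.hasSum_inner_mul_inner x x
    rw [inner_self_eq_norm_sq_to_K] at h
    simp_rw [← inner_conj_symm x, RCLike.conj_mul] at h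
    exact_mod_cast h
  simp_rw [enorm_sq_eq_ofReal]
  rw [← ENNReal.ofReal_tsum_of_nonneg (fun _ => by positivity) parseval.summable, parseval.tsum_eq]

theorem countable_of_hilbertBasis [TopologicalSpace.SeparableSpace H] (e : HilbertBasis ι ℂ H) :
    Countable ι := by
  have dist_basis : ∀ i j, i ≠ j → dist (e i) (e j) = √2 := by
    intro i j hij
    rw [dist_eq_norm, ← Real.sqrt_sq (norm_nonneg _), @norm_sub_sq ℂ, e.orthonormal.1 i,
      e.orthonormal.1 j, e.orthonormal.2 hij]
    norm_num
  refine Pairwise.countable_of_isOpen_disjoint (s := fun i => Metric.ball (e i) (1 / 2))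
    (fun i j hij => Metric.ball_disjoint_ball ?_) (fun _ => Metric.isOpen_ball)
    (fun i => ⟨e i, by simp⟩)
  rw [dist_basis i j hij]
  norm_num

/-- The absolute sum `∑_j |⟨e_j, A e_j⟩|` of the diagonal of `A` in the basis `e`. -/
noncomputable def diagNorm (e : HilbertBasis ι ℂ H) (A : H →L[ℂ] H) : ℝ≥0∞ :=
  ∑' j, ‖⟪e j, A (e j)⟫_ℂ‖ₑ

theorem diagNorm_add_le (e : HilbertBasis ι ℂ H) (A B : H →L[ℂ] H) :
    diagNorm e (A + B) ≤ diagNorm e A + diagNorm e B := by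
  rw [diagNorm, diagNorm, diagNorm, ← ENNReal.tsum_add]
  gcongr with j
  simp only [add_apply, inner_add_right]
  exact enorm_add_le _ _

theorem aemeasurable_diagNorm [Countable ι] (e : HilbertBasis ι ℂ H) {α : Type*}
    [MeasurableSpace α] {μ : Measure α} {F : α → H →L[ℂ] H} (hF : AEStronglyMeasurable F μ) :
    AEMeasurable (fun x => diagNorm e (F x)) μ :=
  AEMeasurable.tsum fun j =>
    ((continuous_const.inner (ContinuousLinearMap.apply ℂ H (e j)).continuous)
      |>.comp_aestronglyMeasurable hF).enorm

/-- The finitely many columns `(A e_j)_{j ∈ J}` of `A`, with the norm of the Hilbert direct sum.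
The Hilbert–Schmidt norm is the supremum of the norms of these sections, through which it inherits
the triangle inequality and Minkowski's integral inequality from a normed space. -/
noncomputable def finiteSection (e : HilbertBasis ι ℂ H) (J : Finset ι) :
    (H →L[ℂ] H) →L[ℂ] PiLp 2 (fun _ : J => H) :=
  (PiLp.continuousLinearEquiv 2 ℂ (fun _ : J => H)).symm.toContinuousLinearMap.comp
    (ContinuousLinearMap.pi fun j : J => ContinuousLinearMap.apply ℂ H (e j))

theorem enorm_finiteSection_sq (e : HilbertBasis ι ℂ H) (J : Finset ι) (A : H →L[ℂ] H) :
    ‖finiteSection e J A‖ₑ ^ 2 = ∑ j ∈ J, ‖A (e j)‖ₑ ^ 2 := by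
  simp_rw [enorm_sq_eq_ofReal]
  rw [PiLp.norm_sq_eq_of_L2, ENNReal.ofReal_sum_of_nonneg (fun _ _ => by positivity),
    ← Finset.sum_coe_sort J]
  rfl

theorem norm_apply_le_norm_add_smul {B : H →L[ℂ] H} (hB : 0 ≤ B) {ε : ℝ} (hε : 0 ≤ ε) (y : H) :
    ‖B y‖ ≤ ‖B y + (ε : ℂ) • y‖ := by
  refine le_of_sq_le_sq ?_ (norm_nonneg _)
  have cross_nonneg : 0 ≤ RCLike.re ⟪B y, (ε : ℂ) • y⟫_ℂ := by
    have := ((ContinuousLinearMap.nonneg_iff_isPositive B).1 hB).re_inner_nonneg_left y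
    rw [inner_smul_right]
    simpa using mul_nonneg hε this
  rw [@norm_add_sq ℂ]
  nlinarith [sq_nonneg ‖(ε : ℂ) • y‖]

theorem enorm_inner_smul_contraction_le (e : HilbertBasis ι ℂ H) {V : H →L[ℂ] H}
    (hV : ‖V‖ₑ ≤ 1) (c : ℂ) (j : ι) : ‖⟪e j, (c • V) (e j)⟫_ℂ‖ₑ ≤ ‖c‖ₑ :=
  calc ‖⟪e j, (c • V) (e j)⟫_ℂ‖ₑ ≤ ‖e j‖ₑ * (‖c‖ₑ * (‖V‖ₑ * ‖e j‖ₑ)) := by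
        refine (enorm_inner_le _ _).trans ?_
        rw [smul_apply, enorm_smul]
        gcongr
        exact V.le_opENorm _
    _ ≤ 1 * (‖c‖ₑ * (1 * 1)) := by rw [enorm_hilbertBasis]; gcongr
    _ = ‖c‖ₑ := by simp

variable [CompleteSpace H]

theorem ofReal_re_inner_star_mul_self (A : H →L[ℂ] H) (x : H) :
    ENNReal.ofReal (RCLike.re ⟪(star A * A) x, x⟫_ℂ) = ‖A x‖ₑ ^ 2 := by
  rw [mul_apply_eq_comp, ContinuousLinearMap.star_eq_adjoint,
    ContinuousLinearMap.adjoint_inner_left, inner_self_eq_norm_sq, enorm_sq_eq_ofReal]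

theorem hsNorm_eq_rpow_tsum (e : HilbertBasis ι ℂ H) (A : H →L[ℂ] H) :
    hsNorm e A = (∑' j, ‖A (e j)‖ₑ ^ 2) ^ (1 / 2 : ℝ) := by
  have sqrt_sq : CFC.sqrt (star (star A * A) * (star A * A)) = star A * A := by
    rw [star_star_mul]
    exact CFC.sqrt_mul_self _ (star_mul_self_nonneg A)
  simp_rw [hsNorm, traceNorm, sqrt_sq, ofReal_re_inner_star_mul_self]

theorem hsNorm_sq (e : HilbertBasis ι ℂ H) (A : H →L[ℂ] H) :
    hsNorm e A ^ 2 = ∑' j, ‖A (e j)‖ₑ ^ 2 := by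
  rw [hsNorm_eq_rpow_tsum, one_div]
  exact mod_cast ENNReal.rpow_inv_natCast_pow two_ne_zero _

theorem hsNorm_congr (e : HilbertBasis ι ℂ H) {A B : H →L[ℂ] H} (h : ∀ x, ‖A x‖ = ‖B x‖) :
    hsNorm e A = hsNorm e B := by
  simp_rw [hsNorm_eq_rpow_tsum, enorm_sq_eq_ofReal, h]

theorem hsNorm_star (e : HilbertBasis ι ℂ H) (A : H →L[ℂ] H) : hsNorm e (star A) = hsNorm e A := by
  simp_rw [hsNorm_eq_rpow_tsum, ← tsum_enorm_inner_sq e]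
  rw [ENNReal.tsum_comm]
  congr! 6 with j k
  rw [ContinuousLinearMap.star_eq_adjoint, ContinuousLinearMap.adjoint_inner_right,
    ← inner_conj_symm, RCLike.enorm_conj]

theorem tsum_enorm_mul_enorm_le (e : HilbertBasis ι ℂ H) (A B : H →L[ℂ] H) :
    ∑' j, ‖A (e j)‖ₑ * ‖B (e j)‖ₑ ≤ hsNorm e A * hsNorm e B := by
  simpa only [hsNorm_eq_rpow_tsum] using tsum_mul_le_rpow_tsum_sq _ _

theorem enorm_le_hsNorm (e : HilbertBasis ι ℂ H) (A : H →L[ℂ] H) : ‖A‖ₑ ≤ hsNorm e A := by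
  refine ContinuousLinearMap.opENorm_le_bound _ fun x => ?_
  rw [← ENNReal.pow_le_pow_left_iff two_ne_zero, mul_pow, ← hsNorm_star, hsNorm_sq,
    ← tsum_enorm_inner_sq e, ← ENNReal.tsum_mul_right]
  gcongr with j
  rw [← mul_pow, ContinuousLinearMap.star_eq_adjoint,
    ← ContinuousLinearMap.adjoint_inner_left]
  gcongr
  exact enorm_inner_le _ _

theorem hsNorm_mul_le (e : HilbertBasis ι ℂ H) (A B : H →L[ℂ] H) :
    hsNorm e (A * B) ≤ ‖A‖ₑ * hsNorm e B := by
  rw [← ENNReal.pow_le_pow_left_iff two_ne_zero, mul_pow, hsNorm_sq, hsNorm_sq,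
    ← ENNReal.tsum_mul_left]
  gcongr with j
  rw [← mul_pow]
  gcongr
  exact A.le_opENorm _

theorem hsNorm_smul (e : HilbertBasis ι ℂ H) (c : ℂ) (A : H →L[ℂ] H) :
    hsNorm e (c • A) = ‖c‖ₑ * hsNorm e A := by
  apply ENNReal.rpow_left_injective two_ne_zero
  simp only [ENNReal.rpow_ofNat, mul_pow, hsNorm_sq, smul_apply, enorm_smul,
    ENNReal.tsum_mul_left]

theorem hsNorm_zero (e : HilbertBasis ι ℂ H) : hsNorm e 0 = 0 := by
  simp [hsNorm_eq_rpow_tsum]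

theorem aemeasurable_hsNorm [Countable ι] (e : HilbertBasis ι ℂ H) {α : Type*} [MeasurableSpace α]
    {μ : Measure α} {F : α → H →L[ℂ] H} (hF : AEStronglyMeasurable F μ) :
    AEMeasurable (fun x => hsNorm e (F x)) μ := by
  simp_rw [hsNorm_eq_rpow_tsum]
  exact (AEMeasurable.tsum fun j =>
    ((ContinuousLinearMap.apply ℂ H (e j)).continuous.comp_aestronglyMeasurable
      hF).enorm.pow_const _).pow_const _

theorem enorm_finiteSection_le (e : HilbertBasis ι ℂ H) (J : Finset ι) (A : H →L[ℂ] H) :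
    ‖finiteSection e J A‖ₑ ≤ hsNorm e A := by
  rw [← ENNReal.pow_le_pow_left_iff two_ne_zero, enorm_finiteSection_sq, hsNorm_sq]
  exact ENNReal.sum_le_tsum J

theorem hsNorm_le_of_finiteSection_le {e : HilbertBasis ι ℂ H} {A : H →L[ℂ] H} {c : ℝ≥0∞}
    (h : ∀ J, ‖finiteSection e J A‖ₑ ≤ c) : hsNorm e A ≤ c := by
  rw [← ENNReal.pow_le_pow_left_iff two_ne_zero, hsNorm_sq, ENNReal.tsum_eq_iSup_sum]
  refine iSup_le fun J => ?_
  rw [← enorm_finiteSection_sq]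
  gcongr
  exact h J

theorem hsNorm_add_le (e : HilbertBasis ι ℂ H) (A B : H →L[ℂ] H) :
    hsNorm e (A + B) ≤ hsNorm e A + hsNorm e B := by
  refine hsNorm_le_of_finiteSection_le fun J => ?_
  rw [map_add]
  refine (enorm_add_le _ _).trans ?_
  gcongr <;> exact enorm_finiteSection_le e J _

theorem hsNorm_integral_le (e : HilbertBasis ι ℂ H) {α : Type*} [MeasurableSpace α]
    {μ : Measure α} (F : α → H →L[ℂ] H) :
    hsNorm e (∫ x, F x ∂μ) ≤ ∫⁻ x, hsNorm e (F x) ∂μ := by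
  by_cases hF : Integrable F μ
  · refine hsNorm_le_of_finiteSection_le fun J => ?_
    rw [← ContinuousLinearMap.integral_comp_comm _ hF]
    exact (enorm_integral_le_lintegral_enorm _).trans
      (lintegral_mono fun x => enorm_finiteSection_le e J _)
  · rw [integral_undef hF, hsNorm_zero]
    exact zero_le

theorem enorm_hsInner_le (e : HilbertBasis ι ℂ H) (A B : H →L[ℂ] H) :
    ‖hsInner e A B‖ₑ ≤ hsNorm e A * hsNorm e B := by
  refine enorm_tsum_le_tsum_enorm.trans (le_trans ?_ (tsum_enorm_mul_enorm_le e A B))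
  gcongr with j
  rw [ContinuousLinearMap.star_eq_adjoint, mul_apply_eq_comp,
    ContinuousLinearMap.adjoint_inner_right]
  exact enorm_inner_le _ _

theorem diagNorm_mul_le (e : HilbertBasis ι ℂ H) (A B : H →L[ℂ] H) :
    diagNorm e (A * B) ≤ hsNorm e A * hsNorm e B := by
  rw [← hsNorm_star e A]
  refine le_trans ?_ (tsum_enorm_mul_enorm_le e (star A) B)
  rw [diagNorm]
  gcongr with j
  rw [mul_apply_eq_comp, ← ContinuousLinearMap.adjoint_inner_left]
  exact enorm_inner_le _ _

theorem norm_abs_apply (A : H →L[ℂ] H) (x : H) : ‖CFC.abs A x‖ = ‖A x‖ := by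
  have sq_eq : ‖CFC.abs A x‖ₑ ^ 2 = ‖A x‖ₑ ^ 2 := by
    rw [← ofReal_re_inner_star_mul_self, (CFC.abs_nonneg A).isSelfAdjoint.star_eq,
      CFC.abs_mul_abs, ofReal_re_inner_star_mul_self]
  rw [enorm_sq_eq_ofReal, enorm_sq_eq_ofReal,
    ENNReal.ofReal_eq_ofReal_iff (sq_nonneg _) (sq_nonneg _)] at sq_eq
  exact (sq_eq_sq₀ (norm_nonneg _) (norm_nonneg _)).1 sq_eq

theorem traceNorm_eq_hsNorm_sqrt_abs_sq (e : HilbertBasis ι ℂ H) (A : H →L[ℂ] H) :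
    traceNorm e A = hsNorm e (CFC.sqrt (CFC.abs A)) ^ 2 := by
  rw [hsNorm_sq]
  refine tsum_congr fun j => ?_
  rw [← ofReal_re_inner_star_mul_self, (CFC.sqrt_nonneg (CFC.abs A)).isSelfAdjoint.star_eq,
    CFC.sqrt_mul_sqrt_self _ (CFC.abs_nonneg A)]
  rfl

theorem hsNorm_le_traceNorm (e : HilbertBasis ι ℂ H) (A : H →L[ℂ] H) :
    hsNorm e A ≤ traceNorm e A := by
  set Q := CFC.sqrt (CFC.abs A) with hQ
  calc hsNorm e A = hsNorm e (Q * Q) := by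
        rw [hQ, CFC.sqrt_mul_sqrt_self _ (CFC.abs_nonneg A)]
        exact hsNorm_congr e fun x => (norm_abs_apply A x).symm
    _ ≤ ‖Q‖ₑ * hsNorm e Q := hsNorm_mul_le e Q Q
    _ ≤ hsNorm e Q * hsNorm e Q := by gcongr; exact enorm_le_hsNorm e Q
    _ = traceNorm e A := by rw [traceNorm_eq_hsNorm_sqrt_abs_sq, sq]

theorem isUnit_add_smul_one {B : H →L[ℂ] H} (hB : 0 ≤ B) {ε : ℝ} (hε : 0 < ε) :
    IsUnit (B + (ε : ℂ) • (1 : H →L[ℂ] H)) := by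
  refine CStarAlgebra.isUnit_of_le ((ε : ℂ) • (1 : H →L[ℂ] H)) (by simpa using hB)
    (IsUnit.isStrictlyPositive ?_ ?_)
  · exact isUnit_one.smul (Units.mk0 (ε : ℂ) (by exact_mod_cast hε.ne'))
  · rw [ContinuousLinearMap.nonneg_iff_isPositive]
    exact ContinuousLinearMap.isPositive_one.smul_of_nonneg (by exact_mod_cast hε.le)

/-- Taking `V = A (|A| + ε)⁻¹` avoids the partial isometry of the exact polar decomposition. -/
theorem exists_contraction_approx_polar (A : H →L[ℂ] H) {ε : ℝ} (hε : 0 < ε) :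
    ∃ V : H →L[ℂ] H, ‖V‖ₑ ≤ 1 ∧ A = V * CFC.abs A + (ε : ℂ) • V := by
  obtain ⟨W, hWr, hWl⟩ := isUnit_iff_exists.1 (isUnit_add_smul_one (CFC.abs_nonneg A) hε)
  refine ⟨A * W, ?_, ?_⟩
  · rw [← ofReal_norm, ENNReal.ofReal_le_one]
    refine ContinuousLinearMap.opNorm_le_bound _ zero_le_one fun x => ?_
    have right_inv : CFC.abs A (W x) + (ε : ℂ) • W x = x := by
      simpa using DFunLike.congr_fun hWr x
    have := norm_apply_le_norm_add_smul (CFC.abs_nonneg A) hε.le (W x)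
    rw [right_inv, norm_abs_apply] at this
    simpa using this
  · calc A = A * (W * (CFC.abs A + (ε : ℂ) • (1 : H →L[ℂ] H))) := by rw [hWl, mul_one]
      _ = _ := by rw [mul_add, mul_add, mul_smul_comm, mul_one, mul_smul_comm, mul_assoc]

theorem diagNorm_contraction_mul_abs_le (e : HilbertBasis ι ℂ H) {V : H →L[ℂ] H} (hV : ‖V‖ₑ ≤ 1)
    (A : H →L[ℂ] H) : diagNorm e (V * CFC.abs A) ≤ traceNorm e A := by
  set Q := CFC.sqrt (CFC.abs A) with hQ
  calc diagNorm e (V * CFC.abs A) = diagNorm e (V * Q * Q) := by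
        rw [mul_assoc, hQ, CFC.sqrt_mul_sqrt_self _ (CFC.abs_nonneg A)]
    _ ≤ hsNorm e (V * Q) * hsNorm e Q := diagNorm_mul_le e _ _
    _ ≤ 1 * hsNorm e Q * hsNorm e Q := by
        gcongr
        exact (hsNorm_mul_le e V Q).trans (by gcongr)
    _ = traceNorm e A := by rw [traceNorm_eq_hsNorm_sqrt_abs_sq, one_mul, sq]

theorem diagNorm_le_traceNorm (e : HilbertBasis ι ℂ H) (A : H →L[ℂ] H) :
    diagNorm e A ≤ traceNorm e A := by
  rw [diagNorm, ENNReal.tsum_eq_iSup_sum]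
  refine iSup_le fun J => ?_
  have approx : ∀ ε : ℝ, 0 < ε →
      ∑ j ∈ J, ‖⟪e j, A (e j)⟫_ℂ‖ₑ ≤ traceNorm e A + J.card * ENNReal.ofReal ε := by
    intro ε hε
    obtain ⟨V, hV, hAV⟩ := exists_contraction_approx_polar A hε
    calc ∑ j ∈ J, ‖⟪e j, A (e j)⟫_ℂ‖ₑ
        = ∑ j ∈ J, ‖⟪e j, (V * CFC.abs A) (e j)⟫_ℂ + ⟪e j, ((ε : ℂ) • V) (e j)⟫_ℂ‖ₑ := by
          simp_rw [← inner_add_right, ← add_apply, ← hAV]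
      _ ≤ ∑ j ∈ J, (‖⟪e j, (V * CFC.abs A) (e j)⟫_ℂ‖ₑ + ‖(ε : ℂ)‖ₑ) := by
          gcongr with j
          refine (enorm_add_le _ _).trans ?_
          gcongr
          exact enorm_inner_smul_contraction_le e hV _ j
      _ = ∑ j ∈ J, ‖⟪e j, (V * CFC.abs A) (e j)⟫_ℂ‖ₑ + J.card * ENNReal.ofReal ε := by
          rw [Finset.sum_add_distrib, Finset.sum_const, nsmul_eq_mul, ← ofReal_norm,
            Complex.norm_real, Real.norm_of_nonneg hε.le]
      _ ≤ traceNorm e A + J.card * ENNReal.ofReal ε := by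
          gcongr
          exact (ENNReal.sum_le_tsum J).trans (diagNorm_contraction_mul_abs_le e hV A)
  have limit : Tendsto (fun ε : ℝ => traceNorm e A + J.card * ENNReal.ofReal ε) (𝓝[>] 0)
      (𝓝 (traceNorm e A + J.card * ENNReal.ofReal 0)) :=
    Tendsto.const_add _ (ENNReal.Tendsto.const_mul
      ((ENNReal.continuous_ofReal.tendsto 0).mono_left nhdsWithin_le_nhds) (Or.inr (by simp)))
  simp only [ENNReal.ofReal_zero, mul_zero, add_zero] at limit
  exact ge_of_tendsto limit (eventually_mem_nhdsWithin.mono approx)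

/-- A measurable subadditive quantity below the trace norm that dominates everything the variance
bound needs of a covariance operator. It replaces the trace norm where measurability matters, such
as under lattice sums compared with integrals. -/
noncomputable def weakTraceNorm (e : HilbertBasis ι ℂ H) (A : H →L[ℂ] H) : ℝ≥0∞ :=
  max (diagNorm e A) (hsNorm e A)

theorem weakTraceNorm_le_traceNorm (e : HilbertBasis ι ℂ H) (A : H →L[ℂ] H) :
    weakTraceNorm e A ≤ traceNorm e A :=
  max_le (diagNorm_le_traceNorm e A) (hsNorm_le_traceNorm e A)

theorem weakTraceNorm_add_le (e : HilbertBasis ι ℂ H) (A B : H →L[ℂ] H) :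
    weakTraceNorm e (A + B) ≤ weakTraceNorm e A + weakTraceNorm e B :=
  max_le
    ((diagNorm_add_le e A B).trans (add_le_add (le_max_left _ _) (le_max_left _ _)))
    ((hsNorm_add_le e A B).trans (add_le_add (le_max_right _ _) (le_max_right _ _)))

theorem aemeasurable_weakTraceNorm [Countable ι] (e : HilbertBasis ι ℂ H) {α : Type*}
    [MeasurableSpace α] {μ : Measure α} {F : α → H →L[ℂ] H} (hF : AEStronglyMeasurable F μ) :
    AEMeasurable (fun x => weakTraceNorm e (F x)) μ :=
  (aemeasurable_diagNorm e hF).max (aemeasurable_hsNorm e hF)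

end HilbertSchmidt

/-! ### Square integrable random operators -/

section SecondOrder

open InnerProductSpace (rankOne)

theorem mul_le_sq_add_sq (a b : ℝ≥0∞) : a * b ≤ a ^ 2 + b ^ 2 := by
  rcases le_total a b with h | h
  · calc a * b ≤ b * b := by gcongr
      _ ≤ a ^ 2 + b ^ 2 := by rw [sq b]; exact le_add_self
  · calc a * b ≤ a * a := by gcongr
      _ ≤ a ^ 2 + b ^ 2 := by rw [sq a]; exact le_self_add

section Vectors

variable {E : Type*} [NormedAddCommGroup E] {Ω : Type*} [MeasurableSpace Ω] {P : Measure Ω}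

theorem lintegral_enorm_sq_lt_top {f : Ω → E} (hf : MemLp f 2 P) : ∫⁻ ω, ‖f ω‖ₑ ^ 2 ∂P < ∞ := by
  simpa using (eLpNorm_lt_top_iff_lintegral_rpow_enorm_lt_top two_ne_zero ENNReal.ofNat_ne_top).1
    hf.2

theorem lintegral_enorm_sq_eq_ofReal_integral {f : Ω → E} (hf : MemLp f 2 P) :
    ∫⁻ ω, ‖f ω‖ₑ ^ 2 ∂P = ENNReal.ofReal (∫ ω, ‖f ω‖ ^ 2 ∂P) := by
  simp_rw [enorm_sq_eq_ofReal]
  exact (ofReal_integral_eq_lintegral_ofReal hf.norm.integrable_sq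
    (ae_of_all _ fun _ => by positivity)).symm

variable [InnerProductSpace ℂ E]

theorem integrable_inner_of_memLp {V W : Ω → E} (hV : MemLp V 2 P) (hW : MemLp W 2 P) :
    Integrable (fun ω => ⟪V ω, W ω⟫_ℂ) P :=
  (hV.norm.integrable_mul hW.norm).mono' (hV.1.inner hW.1)
    (ae_of_all _ fun _ => norm_inner_le_norm _ _)

theorem hasSum_integral_inner {ι : Type*} [Countable ι] {f g : ι → Ω → E}
    (hf : ∀ j, AEStronglyMeasurable (f j) P) (hg : ∀ j, AEStronglyMeasurable (g j) P)
    (hf_sq : ∑' j, ∫⁻ ω, ‖f j ω‖ₑ ^ 2 ∂P ≠ ∞) (hg_sq : ∑' j, ∫⁻ ω, ‖g j ω‖ₑ ^ 2 ∂P ≠ ∞) :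
    HasSum (fun j => ∫ ω, ⟪f j ω, g j ω⟫_ℂ ∂P) (∫ ω, ∑' j, ⟪f j ω, g j ω⟫_ℂ ∂P) := by
  have summable_lintegral : ∑' j, ∫⁻ ω, ‖⟪f j ω, g j ω⟫_ℂ‖ₑ ∂P ≠ ∞ := by
    refine ne_top_of_le_ne_top (ENNReal.add_ne_top.2 ⟨hf_sq, hg_sq⟩) ?_
    rw [← ENNReal.tsum_add]
    gcongr with j
    rw [← lintegral_add_left' ((hf j).enorm.pow_const 2)]
    gcongr with ω
    exact (enorm_inner_le _ _).trans (mul_le_sq_add_sq _ _)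
  rw [integral_tsum (fun j => (hf j).inner (hg j)) summable_lintegral]
  refine (Summable.of_enorm (ne_top_of_le_ne_top summable_lintegral ?_)).hasSum
  gcongr with j
  exact enorm_integral_le_lintegral_enorm _

theorem norm_sq_sum_smul {κ : Type*} (S : Finset κ) (a : κ → ℂ) (u : κ → E) :
    ((‖∑ p ∈ S, a p • u p‖ ^ 2 : ℝ) : ℂ)
      = ∑ p ∈ S, ∑ q ∈ S, (starRingEnd ℂ (a p) * a q) * ⟪u p, u q⟫_ℂ := by
  rw [Complex.ofReal_pow, ← Complex.coe_algebraMap, ← inner_self_eq_norm_sq_to_K, sum_inner]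
  simp_rw [inner_sum, inner_smul_left, inner_smul_right, mul_assoc]

theorem integral_norm_sq_sum_smul {κ : Type*} (S : Finset κ) (a : κ → ℂ) {U : κ → Ω → E}
    (hU : ∀ p, MemLp (U p) 2 P) :
    ((∫ ω, ‖∑ p ∈ S, a p • U p ω‖ ^ 2 ∂P : ℝ) : ℂ)
      = ∑ p ∈ S, ∑ q ∈ S, (starRingEnd ℂ (a p) * a q) * ∫ ω, ⟪U p ω, U q ω⟫_ℂ ∂P := by
  have integrable_term : ∀ p q,
      Integrable (fun ω => (starRingEnd ℂ (a p) * a q) * ⟪U p ω, U q ω⟫_ℂ) P :=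
    fun p q => (integrable_inner_of_memLp (hU p) (hU q)).const_mul _
  simp_rw [← integral_complex_ofReal, norm_sq_sum_smul, ← integral_const_mul]
  rw [integral_finsetSum S fun p _ => integrable_finsetSum S fun q _ => integrable_term p q]
  exact Finset.sum_congr rfl fun p _ => integral_finsetSum S fun q _ => integrable_term p q

theorem integral_inner_sub_integral [CompleteSpace E] [IsProbabilityMeasure P] {V W : Ω → E}
    (hV : MemLp V 2 P) (hW : MemLp W 2 P) :
    ∫ ω, ⟪V ω - ∫ x, V x ∂P, W ω - ∫ x, W x ∂P⟫_ℂ ∂P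
      = ∫ ω, ⟪V ω, W ω⟫_ℂ ∂P - ⟪∫ x, V x ∂P, ∫ x, W x ∂P⟫_ℂ := by
  set m := ∫ x, V x ∂P with hm
  set m' := ∫ x, W x ∂P
  have hV_int : Integrable V P := hV.integrable one_le_two
  have hW_int : Integrable W P := hW.integrable one_le_two
  have hV_sub_int : Integrable (fun ω => V ω - m) P := hV_int.sub (integrable_const m)
  have left_centred : ∫ ω, ⟪V ω - m, m'⟫_ℂ ∂P = 0 := by
    simp_rw [← inner_conj_symm (V _ - m) m']
    rw [integral_conj, integral_inner hV_sub_int, integral_sub hV_int (integrable_const m)]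
    simp [hm]
  have right_term : ∫ ω, ⟪m, W ω⟫_ℂ ∂P = ⟪m, m'⟫_ℂ := integral_inner hW_int m
  have hV_sub : MemLp (fun ω => V ω - m) 2 P := hV.sub (memLp_const m)
  simp_rw [inner_sub_right (V _ - m)]
  rw [integral_sub (integrable_inner_of_memLp hV_sub hW)
    (hV_sub_int.inner_const m'), left_centred, sub_zero]
  simp_rw [inner_sub_left]
  rw [integral_sub (integrable_inner_of_memLp hV hW) (hW_int.const_inner m), right_term]

end Vectors

variable {H : Type*} [NormedAddCommGroup H] [InnerProductSpace ℂ H]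
  {ι Ω : Type*} [MeasurableSpace Ω] {P : Measure Ω}

theorem continuous_rankOne : Continuous fun p : H × H => rankOne ℂ p.1 p.2 := by
  have h : Continuous fun p : H × H =>
      ContinuousLinearMap.smulRightL ℂ H H (innerSL ℂ p.2) p.1 := by fun_prop
  exact h

theorem aestronglyMeasurable_rankOne {Y Z : Ω → H} (hY : AEStronglyMeasurable Y P)
    (hZ : AEStronglyMeasurable Z P) :
    AEStronglyMeasurable (β := H →L[ℂ] H) (fun ω => rankOne ℂ (Y ω) (Z ω)) P := by
  have hYZ : AEStronglyMeasurable (fun ω => (Y ω, Z ω)) P := hY.prodMk hZ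
  have h := continuous_rankOne.comp_aestronglyMeasurable hYZ
  exact h

theorem integrable_rankOne {Y Z : Ω → H} (hY : MemLp Y 2 P) (hZ : MemLp Z 2 P) :
    Integrable (fun ω => rankOne ℂ (Y ω) (Z ω)) P := by
  refine (hY.norm.integrable_mul hZ.norm).mono' (aestronglyMeasurable_rankOne hY.1 hZ.1) ?_
  filter_upwards with ω
  simp

variable [CompleteSpace H]

theorem inner_crossCov {Y Z : Ω → H} (hY : MemLp Y 2 P) (hZ : MemLp Z 2 P) (x y : H) :
    ⟪x, crossCov P Y Z y⟫_ℂ = ∫ ω, ⟪Z ω, y⟫_ℂ * ⟪x, Y ω⟫_ℂ ∂P := by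
  have integrable_apply : Integrable (fun ω => rankOne ℂ (Y ω) (Z ω) y) P :=
    (integrable_rankOne hY hZ).apply_continuousLinearMap y
  rw [crossCov, ContinuousLinearMap.integral_apply (integrable_rankOne hY hZ),
    ← integral_inner integrable_apply]
  simp only [InnerProductSpace.rankOne_apply, inner_smul_right]

theorem hasSum_inner_crossCov [Countable ι] (e : HilbertBasis ι ℂ H) {Y Z : Ω → H}
    (hY : MemLp Y 2 P) (hZ : MemLp Z 2 P) :
    HasSum (fun j => ⟪e j, crossCov P Y Z (e j)⟫_ℂ) (∫ ω, ⟪Z ω, Y ω⟫_ℂ ∂P) := by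
  have coords_sq : ∀ {V : Ω → H}, MemLp V 2 P →
      ∑' j, ∫⁻ ω, ‖⟪e j, V ω⟫_ℂ‖ₑ ^ 2 ∂P ≠ ∞ := by
    intro V hV
    rw [← lintegral_tsum fun j => (hV.1.const_inner (c := e j)).enorm.pow_const 2]
    simp_rw [tsum_enorm_inner_sq]
    exact (lintegral_enorm_sq_lt_top hV).ne
  have h := hasSum_integral_inner (fun j => hZ.1.const_inner (c := e j))
    (fun j => hY.1.const_inner (c := e j)) (coords_sq hZ) (coords_sq hY)
  simp only [RCLike.inner_apply', inner_conj_symm, (e.hasSum_inner_mul_inner _ _).tsum_eq] at h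
  simpa only [inner_crossCov hY hZ] using h

theorem enorm_integral_inner_le_diagNorm [Countable ι] (e : HilbertBasis ι ℂ H) {Y Z : Ω → H}
    (hY : MemLp Y 2 P) (hZ : MemLp Z 2 P) :
    ‖∫ ω, ⟪Z ω, Y ω⟫_ℂ ∂P‖ₑ ≤ diagNorm e (crossCov P Y Z) := by
  rw [← (hasSum_inner_crossCov e hY hZ).tsum_eq]
  exact enorm_tsum_le_tsum_enorm

variable {e : HilbertBasis ι ℂ H}

theorem hsInner_eq_tsum (e : HilbertBasis ι ℂ H) (A B : H →L[ℂ] H) :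
    hsInner e A B = ∑' j, ⟪A (e j), B (e j)⟫_ℂ := by
  simp [hsInner, ContinuousLinearMap.star_eq_adjoint, ContinuousLinearMap.adjoint_inner_right]

theorem hasSum_hsInner {A B : H →L[ℂ] H} (hA : hsNorm e A ≠ ∞) (hB : hsNorm e B ≠ ∞) :
    HasSum (fun j => ⟪A (e j), B (e j)⟫_ℂ) (hsInner e A B) := by
  rw [hsInner_eq_tsum]
  refine (Summable.of_enorm (ne_top_of_le_ne_top (ENNReal.mul_ne_top hA hB) ?_)).hasSum
  refine le_trans ?_ (tsum_enorm_mul_enorm_le e A B)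
  gcongr with j
  exact enorm_inner_le _ _

theorem hsNorm_rankOne (e : HilbertBasis ι ℂ H) (x y : H) :
    hsNorm e (rankOne ℂ x y) = ‖x‖ₑ * ‖y‖ₑ := by
  apply ENNReal.rpow_left_injective two_ne_zero
  simp only [ENNReal.rpow_ofNat]
  rw [hsNorm_sq, mul_pow, ← tsum_enorm_inner_sq e y, ← ENNReal.tsum_mul_left]
  refine tsum_congr fun j => ?_
  rw [InnerProductSpace.rankOne_apply, enorm_smul, mul_pow, mul_comm, ← inner_conj_symm,
    RCLike.enorm_conj]

/-- Random Hilbert–Schmidt operators with finite second moment, as operator-valued functions;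
this is `MemLp _ 2` for the Hilbert–Schmidt norm. -/
structure MemHSTwo (e : HilbertBasis ι ℂ H) (P : Measure Ω) (A : Ω → H →L[ℂ] H) : Prop where
  aestronglyMeasurable : AEStronglyMeasurable A P
  lintegral_hsNorm_sq_lt_top : ∫⁻ ω, hsNorm e (A ω) ^ 2 ∂P < ∞

theorem lintegral_hsNorm_sq [Countable ι] {A : Ω → H →L[ℂ] H} (hA : AEStronglyMeasurable A P) :
    ∫⁻ ω, hsNorm e (A ω) ^ 2 ∂P = ∑' j, ∫⁻ ω, ‖A ω (e j)‖ₑ ^ 2 ∂P := by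
  simp_rw [hsNorm_sq]
  exact lintegral_tsum fun j => ((ContinuousLinearMap.apply ℂ H
    (e j)).continuous.comp_aestronglyMeasurable hA).enorm.pow_const 2

namespace MemHSTwo

variable {A B : Ω → H →L[ℂ] H}

theorem memLp (hA : MemHSTwo e P A) : MemLp A 2 P := by
  refine ⟨hA.aestronglyMeasurable, (eLpNorm_lt_top_iff_lintegral_rpow_enorm_lt_top two_ne_zero
    ENNReal.ofNat_ne_top).2 ?_⟩
  refine lt_of_le_of_lt (lintegral_mono fun ω => ?_) hA.lintegral_hsNorm_sq_lt_top
  simp only [ENNReal.toReal_ofNat, ENNReal.rpow_ofNat]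
  gcongr
  exact enorm_le_hsNorm e _

theorem memLp_apply (hA : MemHSTwo e P A) (x : H) : MemLp (fun ω => A ω x) 2 P :=
  (ContinuousLinearMap.apply ℂ H x).comp_memLp' hA.memLp

theorem tsum_lintegral_enorm_sq_ne_top [Countable ι] (hA : MemHSTwo e P A) :
    ∑' j, ∫⁻ ω, ‖A ω (e j)‖ₑ ^ 2 ∂P ≠ ∞ := by
  rw [← lintegral_hsNorm_sq hA.aestronglyMeasurable]
  exact hA.lintegral_hsNorm_sq_lt_top.ne

variable [IsProbabilityMeasure P]

theorem integral_apply (hA : MemHSTwo e P A) (x : H) :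
    (∫ ω, A ω ∂P) x = ∫ ω, A ω x ∂P :=
  ContinuousLinearMap.integral_apply (hA.memLp.integrable one_le_two) x

theorem hsNorm_integral_ne_top (hA : MemHSTwo e P A) : hsNorm e (∫ ω, A ω ∂P) ≠ ∞ := by
  refine ((hsNorm_integral_le e A).trans_lt ?_).ne
  calc ∫⁻ ω, hsNorm e (A ω) ∂P ≤ ∫⁻ ω, (1 + hsNorm e (A ω) ^ 2) ∂P := by
        gcongr with ω
        simpa using mul_le_sq_add_sq 1 (hsNorm e (A ω))
    _ = 1 + ∫⁻ ω, hsNorm e (A ω) ^ 2 ∂P := by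
        rw [lintegral_add_left measurable_const]
        simp
    _ < ∞ := ENNReal.add_lt_top.2 ⟨ENNReal.one_lt_top, hA.lintegral_hsNorm_sq_lt_top⟩

end MemHSTwo

/-- The covariance `𝔼⟨A, B⟩_HS - ⟨𝔼A, 𝔼B⟩_HS` of two random Hilbert–Schmidt operators. -/
noncomputable def hsCov (e : HilbertBasis ι ℂ H) (P : Measure Ω) (A B : Ω → H →L[ℂ] H) : ℂ :=
  (∫ ω, hsInner e (A ω) (B ω) ∂P) - hsInner e (∫ ω, A ω ∂P) (∫ ω, B ω ∂P)

variable [Countable ι] [IsProbabilityMeasure P]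

theorem hasSum_hsCov {A B : Ω → H →L[ℂ] H} (hA : MemHSTwo e P A) (hB : MemHSTwo e P B) :
    HasSum (fun j => ∫ ω, ⟪A ω (e j) - ∫ x, A x (e j) ∂P, B ω (e j) - ∫ x, B x (e j) ∂P⟫_ℂ ∂P)
      (hsCov e P A B) := by
  simp_rw [integral_inner_sub_integral (hA.memLp_apply _) (hB.memLp_apply _),
    ← hA.integral_apply, ← hB.integral_apply]
  refine HasSum.sub ?_ (hasSum_hsInner hA.hsNorm_integral_ne_top hB.hsNorm_integral_ne_top)
  simp_rw [hsInner_eq_tsum]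
  exact hasSum_integral_inner (fun j => (hA.memLp_apply (e j)).1)
    (fun j => (hB.memLp_apply (e j)).1) hA.tsum_lintegral_enorm_sq_ne_top
    hB.tsum_lintegral_enorm_sq_ne_top

theorem hasSum_integral_norm_sq_sum_centred {κ : Type*} (S : Finset κ) (a : κ → ℂ)
    {A : κ → Ω → H →L[ℂ] H} (hA : ∀ p, MemHSTwo e P (A p)) :
    HasSum (fun j => ∫ ω, ‖∑ p ∈ S, a p • (A p ω (e j) - ∫ x, A p x (e j) ∂P)‖ ^ 2 ∂P)
      (∑ p ∈ S, ∑ q ∈ S, (starRingEnd ℂ (a p) * a q) * hsCov e P (A p) (A q)).re := by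
  have columns : HasSum
      (fun j => ∑ p ∈ S, ∑ q ∈ S, (starRingEnd ℂ (a p) * a q) *
        ∫ ω, ⟪A p ω (e j) - ∫ x, A p x (e j) ∂P, A q ω (e j) - ∫ x, A q x (e j) ∂P⟫_ℂ ∂P)
      (∑ p ∈ S, ∑ q ∈ S, (starRingEnd ℂ (a p) * a q) * hsCov e P (A p) (A q)) :=
    hasSum_sum fun p _ => hasSum_sum fun q _ => (hasSum_hsCov (hA p) (hA q)).mul_left _
  refine (Complex.reCLM.hasSum columns).congr_fun fun j => ?_
  have centred_memLp : ∀ p, MemLp (fun ω => A p ω (e j) - ∫ x, A p x (e j) ∂P) 2 P :=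
    fun p => ((hA p).memLp_apply (e j)).sub (memLp_const _)
  change _ = Complex.re _
  rw [← integral_norm_sq_sum_smul S a centred_memLp]
  exact (Complex.ofReal_re _).symm

theorem lintegral_hsNorm_sq_sum_centred_le {κ : Type*} (S : Finset κ) (a : κ → ℂ)
    {A : κ → Ω → H →L[ℂ] H} (hA : ∀ p, MemHSTwo e P (A p)) :
    ∫⁻ ω, hsNorm e (∑ p ∈ S, a p • (A p ω - ∫ x, A p x ∂P)) ^ 2 ∂P
      ≤ ∑ p ∈ S, ∑ q ∈ S, ‖a p‖ₑ * ‖a q‖ₑ * ‖hsCov e P (A p) (A q)‖ₑ := by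
  have column_memLp : ∀ j,
      MemLp (fun ω => ∑ p ∈ S, a p • (A p ω (e j) - ∫ x, A p x (e j) ∂P)) 2 P :=
    fun j => memLp_finsetSum S fun p _ =>
      (((hA p).memLp_apply (e j)).sub (memLp_const _)).const_smul (a p)
  have column_eq : ∀ j ω, (∑ p ∈ S, a p • (A p ω - ∫ x, A p x ∂P)) (e j)
      = ∑ p ∈ S, a p • (A p ω (e j) - ∫ x, A p x (e j) ∂P) := fun j ω => by
    simp only [sum_apply, smul_apply, sub_apply, (hA _).integral_apply]
  have sum_measurable :
      AEStronglyMeasurable (fun ω => ∑ p ∈ S, a p • (A p ω - ∫ x, A p x ∂P)) P :=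
    Finset.aestronglyMeasurable_fun_sum S fun p _ =>
      ((hA p).aestronglyMeasurable.sub aestronglyMeasurable_const).const_smul (a p)
  have total := hasSum_integral_norm_sq_sum_centred S a hA
  calc ∫⁻ ω, hsNorm e (∑ p ∈ S, a p • (A p ω - ∫ x, A p x ∂P)) ^ 2 ∂P
      = ∑' j, ENNReal.ofReal
          (∫ ω, ‖∑ p ∈ S, a p • (A p ω (e j) - ∫ x, A p x (e j) ∂P)‖ ^ 2 ∂P) := by
        rw [lintegral_hsNorm_sq sum_measurable]
        refine tsum_congr fun j => ?_
        rw [← lintegral_enorm_sq_eq_ofReal_integral (column_memLp j)]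
        simp_rw [column_eq]
    _ = ENNReal.ofReal
          (∑ p ∈ S, ∑ q ∈ S, (starRingEnd ℂ (a p) * a q) * hsCov e P (A p) (A q)).re := by
        rw [← ENNReal.ofReal_tsum_of_nonneg (fun j => integral_nonneg fun _ => by positivity)
          total.summable, total.tsum_eq]
    _ ≤ ‖∑ p ∈ S, ∑ q ∈ S, (starRingEnd ℂ (a p) * a q) * hsCov e P (A p) (A q)‖ₑ := by
        rw [← ofReal_norm]
        exact ENNReal.ofReal_le_ofReal (Complex.re_le_norm _)
    _ ≤ ∑ p ∈ S, ∑ q ∈ S, ‖a p‖ₑ * ‖a q‖ₑ * ‖hsCov e P (A p) (A q)‖ₑ := by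
        refine (enorm_sum_le _ _).trans (Finset.sum_le_sum fun p _ => ?_)
        refine (enorm_sum_le _ _).trans_eq (Finset.sum_congr rfl fun q _ => ?_)
        rw [enorm_mul, enorm_mul, RCLike.enorm_conj]

end SecondOrder

/-! ### Covariances of dyads -/

section CovarianceBounds

variable {H : Type*} [NormedAddCommGroup H] [InnerProductSpace ℂ H]
  {ι Ω : Type*} [MeasurableSpace Ω] {P : Measure Ω} {d : ℕ}

open InnerProductSpace (rankOne)

instance : ENNReal.HolderTriple 4 4 2 where
  inv_add_inv_eq_inv := by
    rw [← two_mul, ← ENNReal.toReal_eq_toReal_iff' (by finiteness) (by finiteness)]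
    norm_num

theorem crossCov_congr {Y Y' Z Z' : Ω → H} (hY : Y =ᵐ[P] Y') (hZ : Z =ᵐ[P] Z') :
    crossCov P Y Z = crossCov P Y' Z' := by
  refine integral_congr_ae ?_
  filter_upwards [hY, hZ] with ω hYω hZω
  rw [hYω, hZω]

variable {e : HilbertBasis ι ℂ H} {X : Pt d → Ω → H}

theorem IsStationaryRealProcess.crossCov_eq (hX : IsStationaryRealProcess e P X) (t s : Pt d) :
    crossCov P (X t) (X s) = covOp P X (t - s) := by
  rw [covOp, ← hX.cov_shift t s (-s), sub_eq_add_neg, add_neg_cancel]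

theorem IsStationaryRealProcess.crossCov_conjVec_eq (hX : IsStationaryRealProcess e P X)
    (t s : Pt d) : crossCov P (X t) (fun ω => conjVec e (X s ω)) = covOp P X (t - s) := by
  rw [crossCov_congr (EventuallyEq.refl _ _) (hX.real s), hX.crossCov_eq]

variable [CompleteSpace H]

theorem memHSTwo_rankOne {Y Z : Ω → H} (hY : MemLp Y 4 P) (hZ : MemLp Z 4 P) :
    MemHSTwo e P fun ω => rankOne ℂ (Y ω) (Z ω) := by
  refine ⟨aestronglyMeasurable_rankOne hY.1 hZ.1, ?_⟩
  simpa [hsNorm_rankOne, enorm_mul] using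
    lintegral_enorm_sq_lt_top (MemLp.mul' (p := 4) (q := 4) (r := 2) hZ.norm hY.norm)

theorem IsStationaryRealProcess.enorm_hsCov_rankOne_le [Countable ι]
    (hX : IsStationaryRealProcess e P X) (t s t' s' : Pt d) :
    ‖hsCov e P (fun ω => rankOne ℂ (X t ω) (X s ω)) (fun ω => rankOne ℂ (X t' ω) (X s' ω))‖ₑ
      ≤ ‖cum4 e P (X t) (X s) (X t') (X s')‖ₑ
        + weakTraceNorm e (covOp P X (t' - t)) * weakTraceNorm e (covOp P X (s - s'))
        + weakTraceNorm e (covOp P X (t - s')) * weakTraceNorm e (covOp P X (t' - s)) := by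
  have cum4_decomp :
      hsCov e P (fun ω => rankOne ℂ (X t ω) (X s ω)) (fun ω => rankOne ℂ (X t' ω) (X s' ω))
      = cum4 e P (X t) (X s) (X t') (X s')
        + (∫ ω, ⟪X t ω, X t' ω⟫_ℂ ∂P) * (∫ ω, ⟪X s' ω, X s ω⟫_ℂ ∂P)
        + hsInner e (covOp P X (t - s')) (covOp P X (t' - s)) := by
    rw [cum4, hX.crossCov_conjVec_eq, hX.crossCov_conjVec_eq, hsCov, crossCov, crossCov]
    ring
  have moment_le : ∀ r r', ‖∫ ω, ⟪X r ω, X r' ω⟫_ℂ ∂P‖ₑ ≤ weakTraceNorm e (covOp P X (r' - r)) := by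
    intro r r'
    rw [← hX.crossCov_eq]
    exact (enorm_integral_inner_le_diagNorm e (hX.memLp_two r') (hX.memLp_two r)).trans
      (le_max_left _ _)
  rw [cum4_decomp]
  refine (enorm_add_le _ _).trans (add_le_add ((enorm_add_le _ _).trans (add_le_add le_rfl ?_)) ?_)
  · rw [enorm_mul]
    exact mul_le_mul' (moment_le t t') (moment_le s' s)
  · exact (enorm_hsInner_le e _ _).trans (mul_le_mul' (le_max_right _ _) (le_max_right _ _))

theorem integrable_of_lintegral_traceNorm {α : Type*} [MeasurableSpace α] {μ : Measure α}
    {C : α → H →L[ℂ] H} (hC : AEStronglyMeasurable C μ) (hint : ∫⁻ h, traceNorm e (C h) ∂μ < ∞) :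
    Integrable C μ :=
  ⟨hC, (lintegral_mono fun _ =>
    (enorm_le_hsNorm e _).trans (hsNorm_le_traceNorm e _)).trans_lt hint⟩

end CovarianceBounds

/-! ### The observation lattice -/

section Grid

variable {d : ℕ}

/-- The point of the lattice `δ ℤᵈ` with integer coordinates `k`. -/
noncomputable def latticePt (δ : ℝ) (k : Fin d → ℤ) : Pt d := WithLp.toLp 2 fun l => (k l : ℝ) * δ

/-- The index of the half-open lattice cell `∏ₗ [kₗ δ, (kₗ + 1) δ)` containing `x`. -/
noncomputable def cellIdx (δ : ℝ) (x : Pt d) : Fin d → ℤ := fun l => ⌊x l / δ⌋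

/-- The indices of the observation grid, as integer vectors so that differences of indices are
again indices. -/
noncomputable def gridIdx (N : Fin d → ℕ) : Finset (Fin d → ℤ) :=
  Fintype.piFinset fun l => Finset.Icc 1 (N l : ℤ)

theorem latticePt_apply (δ : ℝ) (k : Fin d → ℤ) (l : Fin d) : latticePt δ k l = k l * δ := rfl

theorem latticePt_sub (δ : ℝ) (k k' : Fin d → ℤ) :
    latticePt δ (k - k') = latticePt δ k - latticePt δ k' := by
  ext l; simp [latticePt, sub_mul]

theorem latticePt_injective {δ : ℝ} (hδ : 0 < δ) :
    Function.Injective (latticePt δ : (Fin d → ℤ) → Pt d) := by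
  intro k k' h
  ext l
  have coord_eq : (k l : ℝ) * δ = k' l * δ := congrArg (fun x : Pt d => x l) h
  exact_mod_cast mul_right_cancel₀ hδ.ne' coord_eq

theorem coe_gridPoints (δ : ℝ) (N : Fin d → ℕ) :
    (gridPoints δ N : Set (Pt d)) = latticePt δ '' (gridIdx N : Set (Fin d → ℤ)) := by
  classical
  ext x
  simp only [gridPoints, gridIdx, Finset.coe_image, Set.mem_image, Finset.mem_coe,
    Fintype.mem_piFinset, Finset.mem_Icc]
  constructor
  · rintro ⟨k, hk, rfl⟩
    exact ⟨fun l => k l, fun l => ⟨Int.ofNat_le.2 (hk l).1, Int.ofNat_le.2 (hk l).2⟩,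
      by simp [latticePt]⟩
  · rintro ⟨k, hk, rfl⟩
    lift k to Fin d → ℕ using fun l => by linarith [(hk l).1]
    exact ⟨k, fun l => ⟨Int.ofNat_le.1 (hk l).1, Int.ofNat_le.1 (hk l).2⟩, by simp [latticePt]⟩

theorem sum_gridPoints {δ : ℝ} (hδ : 0 < δ) (N : Fin d → ℕ) {M : Type*} [AddCommMonoid M]
    (F : Pt d → M) : ∑ t ∈ gridPoints δ N, F t = ∑ k ∈ gridIdx N, F (latticePt δ k) := by
  classical
  have gridPoints_eq_image : gridPoints δ N = (gridIdx N).image (latticePt δ) := by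
    apply Finset.coe_injective
    rw [coe_gridPoints, Finset.coe_image]
  rw [gridPoints_eq_image, Finset.sum_image fun k _ k' _ hk => latticePt_injective hδ hk]

theorem norm_latticePt_cellIdx_sub_le {δ : ℝ} (hδ : 0 < δ) (x : Pt d) :
    ‖latticePt δ (cellIdx δ x) - x‖ ≤ √d * δ := by
  rw [EuclideanSpace.norm_eq]
  have coord_le : ∀ l, ‖(latticePt δ (cellIdx δ x) - x) l‖ ^ 2 ≤ δ ^ 2 := by
    intro l
    refine pow_le_pow_left₀ (norm_nonneg _) ?_ 2
    rw [PiLp.sub_apply, latticePt_apply, cellIdx, Real.norm_eq_abs]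
    have floor_le := (le_div_iff₀ hδ).1 (Int.floor_le (x l / δ))
    have lt_floor := (div_lt_iff₀ hδ).1 (Int.lt_floor_add_one (x l / δ))
    rw [abs_le]
    constructor <;> nlinarith
  calc √(∑ l, ‖(latticePt δ (cellIdx δ x) - x) l‖ ^ 2)
      ≤ √(∑ _l : Fin d, δ ^ 2) := Real.sqrt_le_sqrt (Finset.sum_le_sum fun l _ => coord_le l)
    _ = √d * δ := by
      rw [Finset.sum_const, Finset.card_univ, Fintype.card_fin, nsmul_eq_mul,
        Real.sqrt_mul (by positivity), Real.sqrt_sq hδ.le]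

theorem measurable_cellIdx (δ : ℝ) : Measurable (cellIdx δ : Pt d → Fin d → ℤ) := by
  refine measurable_pi_lambda _ fun l => Int.measurable_floor.comp ?_
  exact ((EuclideanSpace.proj (𝕜 := ℝ) l).continuous.measurable).div_const δ

/-- The closed box `∏ₗ [pₗ, qₗ]`, the common form of the two admissible sampling regions. -/
def closedBox (p q : Fin d → ℝ) : Set (Pt d) := {x | ∀ l, p l ≤ x l ∧ x l ≤ q l}

theorem closedBox_eq_preimage (p q : Fin d → ℝ) :
    closedBox p q = (WithLp.ofLp : Pt d → Fin d → ℝ) ⁻¹' Set.Icc p q := by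
  ext x
  simp [closedBox, Pi.le_def, forall_and]

theorem volume_closedBox (p q : Fin d → ℝ) :
    volume (closedBox p q) = ∏ l, ENNReal.ofReal (q l - p l) := by
  rw [closedBox_eq_preimage, (PiLp.volume_preserving_ofLp (Fin d)).measure_preimage
    measurableSet_Icc.nullMeasurableSet, Real.volume_Icc_pi]

theorem volume_real_closedBox {p q : Fin d → ℝ} (h : ∀ l, p l ≤ q l) :
    volume.real (closedBox p q) = ∏ l, (q l - p l) := by
  rw [measureReal_def, volume_closedBox, ENNReal.toReal_prod]
  exact Finset.prod_congr rfl fun l _ => ENNReal.toReal_ofReal (by linarith [h l])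

theorem map_cellIdx_volume {δ : ℝ} (hδ : 0 < δ) :
    Measure.map (cellIdx δ) (volume : Measure (Pt d))
      = ENNReal.ofReal (δ ^ d) • (Measure.count : Measure (Fin d → ℤ)) := by
  refine Measure.ext_of_singleton fun k => ?_
  rw [Measure.map_apply (measurable_cellIdx δ) (MeasurableSet.singleton k), Measure.smul_apply,
    Measure.count_singleton]
  have cell_eq : cellIdx δ ⁻¹' {k} = (WithLp.ofLp : Pt d → Fin d → ℝ) ⁻¹'
      (Set.univ.pi fun l => Set.Ico ((k l : ℝ) * δ) ((k l + 1) * δ)) := by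
    ext x
    simp only [Set.mem_preimage, Set.mem_singleton_iff, funext_iff, cellIdx, Set.mem_pi,
      Set.mem_univ, true_implies, Set.mem_Ico]
    refine forall_congr' fun l => ?_
    rw [Int.floor_eq_iff, le_div_iff₀ hδ, div_lt_iff₀ hδ]
  rw [cell_eq, (PiLp.volume_preserving_ofLp (Fin d)).measure_preimage
    (MeasurableSet.univ_pi fun _ => measurableSet_Ico).nullMeasurableSet, Real.volume_pi_Ico]
  have side_eq : ∀ l, ((k l : ℝ) + 1) * δ - k l * δ = δ := fun l => by ring
  simp [side_eq, ENNReal.ofReal_pow hδ.le]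

theorem lintegral_comp_cellIdx {δ : ℝ} (hδ : 0 < δ) (F : (Fin d → ℤ) → ℝ≥0∞) :
    ∫⁻ x : Pt d, F (cellIdx δ x) = ENNReal.ofReal (δ ^ d) * ∑' k, F k := by
  rw [← lintegral_map (measurable_of_countable F) (measurable_cellIdx δ), map_cellIdx_volume hδ,
    lintegral_smul_measure, lintegral_count, smul_eq_mul]

theorem integrable_comp_cellIdx {δ : ℝ} (hδ : 0 < δ) {E : Type*} [NormedAddCommGroup E]
    {F : (Fin d → ℤ) → E} (S : Finset (Fin d → ℤ)) (hF : ∀ k ∉ S, F k = 0) :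
    Integrable fun x : Pt d => F (cellIdx δ x) := by
  constructor
  · exact (StronglyMeasurable.of_discrete (f := F)).comp_measurable
      (measurable_cellIdx δ) |>.aestronglyMeasurable
  · rw [HasFiniteIntegral, lintegral_comp_cellIdx hδ fun k => ‖F k‖ₑ,
      tsum_eq_sum (s := S) fun k hk => by simp [hF k hk]]
    exact ENNReal.mul_lt_top ENNReal.ofReal_lt_top (ENNReal.sum_lt_top.2 fun _ _ => enorm_lt_top)

theorem integral_comp_cellIdx {δ : ℝ} (hδ : 0 < δ) {E : Type*} [NormedAddCommGroup E]
    [NormedSpace ℝ E] [CompleteSpace E]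
    {F : (Fin d → ℤ) → E} (S : Finset (Fin d → ℤ)) (hF : ∀ k ∉ S, F k = 0) :
    ∫ x : Pt d, F (cellIdx δ x) = δ ^ d • ∑ k ∈ S, F k := by
  have hF_meas : AEStronglyMeasurable F (Measure.map (cellIdx δ) (volume : Measure (Pt d))) :=
    (StronglyMeasurable.of_discrete (f := F)).aestronglyMeasurable
  have integrable_count : Integrable F (Measure.count : Measure (Fin d → ℤ)) := by
    have integrable_map := (integrable_map_measure hF_meas (measurable_cellIdx δ).aemeasurable).2
      (integrable_comp_cellIdx hδ S hF)
    rw [map_cellIdx_volume hδ] at integrable_map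
    exact (integrable_smul_measure (by simpa using pow_pos hδ d) ENNReal.ofReal_ne_top).1
      integrable_map
  rw [← integral_map (measurable_cellIdx δ).aemeasurable hF_meas, map_cellIdx_volume hδ,
    integral_smul_measure, ENNReal.toReal_ofReal (by positivity),
    ← setIntegral_eq_integral_of_forall_compl_eq_zero fun k hk => hF k (mt Finset.mem_coe.2 hk),
    setIntegral_finset S integrable_count.integrableOn]
  simp [measureReal_def]

theorem card_filter_sub_eq (N : Fin d → ℕ) (m : Fin d → ℤ) :
    ((gridIdx N ×ˢ gridIdx N).filter fun p => p.1 - p.2 = m).card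
      = ∏ l, ((N l : ℤ) - |m l|).toNat := by
  classical
  have pairs_eq : ((gridIdx N ×ˢ gridIdx N).filter fun p => p.1 - p.2 = m)
      = (Fintype.piFinset fun l => Finset.Icc (max 1 (1 - m l)) (min (N l : ℤ) (N l - m l))).image
        fun k => (k + m, k) := by
    ext ⟨k, k'⟩
    simp only [gridIdx, Finset.mem_filter, Finset.mem_product, Fintype.mem_piFinset,
      Finset.mem_Icc, Finset.mem_image, Prod.mk.injEq, max_le_iff, le_min_iff]
    constructor
    · rintro ⟨⟨hk, hk'⟩, rfl⟩
      refine ⟨k', fun l => ?_, by simp, rfl⟩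
      grind [hk l, hk' l, Pi.sub_apply k k' l]
    · rintro ⟨k, hk, rfl, rfl⟩
      refine ⟨⟨fun l => ?_, fun l => ?_⟩, by simp⟩ <;> grind [hk l, Pi.add_apply k m l]
  rw [pairs_eq, Finset.card_image_of_injective _ fun a b hab => (Prod.mk.inj hab).2,
    Fintype.card_piFinset]
  refine Finset.prod_congr rfl fun l _ => ?_
  rw [Int.card_Icc]
  grind

theorem sum_sum_gridIdx_sub (N : Fin d → ℕ) {E : Type*} [AddCommMonoid E]
    (F : (Fin d → ℤ) → E) :
    ∑ k ∈ gridIdx N, ∑ k' ∈ gridIdx N, F (k - k')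
      = ∑ m ∈ Fintype.piFinset fun l => Finset.Icc (-(N l : ℤ)) (N l),
          (∏ l, ((N l : ℤ) - |m l|).toNat) • F m := by
  classical
  rw [← Finset.sum_product',
    ← Finset.sum_fiberwise_of_maps_to (s := gridIdx N ×ˢ gridIdx N)
      (t := Fintype.piFinset fun l => Finset.Icc (-(N l : ℤ)) (N l)) (g := fun p => p.1 - p.2)]
  · refine Finset.sum_congr rfl fun m _ => ?_
    rw [← card_filter_sub_eq, ← Finset.sum_const]
    refine Finset.sum_congr rfl fun p hp => ?_
    rw [(Finset.mem_filter.1 hp).2]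
  · rintro ⟨k, k'⟩ hk
    simp only [gridIdx, Finset.mem_product, Fintype.mem_piFinset, Finset.mem_Icc] at hk ⊢
    intro l
    have := hk.1 l; have := hk.2 l
    simp only [Pi.sub_apply]
    omega

theorem closedBox_inter_shift (p q : Fin d → ℝ) (h : Pt d) :
    closedBox p q ∩ (fun x => x - h) '' closedBox p q
      = closedBox (fun l => max (p l) (p l - h l)) (fun l => min (q l) (q l - h l)) := by
  ext x
  simp only [closedBox, Set.mem_inter_iff, Set.mem_ofPred_eq, Set.mem_image, max_le_iff,
    le_min_iff]
  constructor
  · rintro ⟨hx, y, hy, rfl⟩ l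
    have sub_apply : (y - h) l = y l - h l := rfl
    have hxl : p l ≤ (y - h) l ∧ (y - h) l ≤ q l := hx l
    rw [sub_apply] at hxl ⊢
    constructor <;> constructor <;> linarith [hy l]
  · intro hx
    refine ⟨fun l => ⟨(hx l).1.1, (hx l).2.1⟩, x + h, fun l => ?_, by simp⟩
    rw [PiLp.add_apply]
    constructor <;> linarith [hx l]

theorem volume_real_closedBox_inter_shift {p q : Fin d → ℝ} {h : Pt d}
    (hh : ∀ l, |h l| ≤ q l - p l) :
    volume.real (closedBox p q ∩ (fun x => x - h) '' closedBox p q)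
      = ∏ l, (q l - p l - |h l|) := by
  have side_eq : ∀ l, min (q l) (q l - h l) - max (p l) (p l - h l) = q l - p l - |h l| := by
    grind
  rw [closedBox_inter_shift, volume_real_closedBox fun l => by linarith [side_eq l, hh l]]
  exact Finset.prod_congr rfl fun l _ => side_eq l

theorem convexHull_image_natCast_mul_Icc {δ : ℝ} (hδ : 0 < δ) {n : ℕ} (hn : 1 ≤ n) :
    convexHull ℝ ((fun k : ℕ => (k : ℝ) * δ) '' Set.Icc 1 n) = Set.Icc δ (n * δ) := by
  have hle : δ ≤ n * δ := le_mul_of_one_le_left hδ.le (by exact_mod_cast hn)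
  refine Set.Subset.antisymm (convexHull_min ?_ (convex_Icc _ _)) ?_
  · rintro _ ⟨k, ⟨hk_one, hk_n⟩, rfl⟩
    refine ⟨le_mul_of_one_le_left hδ.le (by exact_mod_cast hk_one), ?_⟩
    dsimp only
    gcongr
  · rw [← segment_eq_Icc hle]
    exact segment_subset_convexHull ⟨1, ⟨le_rfl, hn⟩, by simp⟩ ⟨n, ⟨hn, le_rfl⟩, rfl⟩

theorem coe_gridPoints_eq_image_pi (δ : ℝ) (N : Fin d → ℕ) :
    (gridPoints δ N : Set (Pt d)) = (WithLp.linearEquiv 2 ℝ (Fin d → ℝ)).symm ''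
      (Set.univ.pi fun l => (fun k : ℕ => (k : ℝ) * δ) '' Set.Icc 1 (N l)) := by
  ext x
  simp only [gridPoints, Finset.coe_image, Set.mem_image, Finset.mem_coe, Fintype.mem_piFinset,
    Finset.mem_Icc, Set.mem_pi, Set.mem_univ, true_implies, Set.mem_Icc]
  constructor
  · rintro ⟨k, hk, rfl⟩
    exact ⟨fun l => k l * δ, fun l => ⟨k l, hk l, rfl⟩, rfl⟩
  · rintro ⟨y, hy, rfl⟩
    choose k hk hk_eq using hy
    exact ⟨k, hk, by simp [hk_eq]⟩

theorem gridHull_eq_closedBox {δ : ℝ} (hδ : 0 < δ) {N : Fin d → ℕ} (hN : ∀ l, 1 ≤ N l) :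
    gridHull δ N = closedBox (fun _ => δ) (fun l => N l * δ) := by
  have convexHull_eq : convexHull ℝ (gridPoints δ N : Set (Pt d))
      = closedBox (fun _ => δ) (fun l => N l * δ) := by
    rw [coe_gridPoints_eq_image_pi, ← LinearEquiv.coe_coe, ← LinearMap.image_convexHull,
      convexHull_pi]
    simp_rw [convexHull_image_natCast_mul_Icc hδ (hN _)]
    rw [LinearEquiv.coe_coe, LinearEquiv.image_symm_eq_preimage, closedBox_eq_preimage,
      Set.pi_univ_Icc]
    rfl
  rw [gridHull, closedConvexHull_eq_closure_convexHull, convexHull_eq, closedBox_eq_preimage]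
  exact (isClosed_Icc.preimage (PiLp.continuous_ofLp 2 _)).closure_eq

theorem gridPoints_eq_empty {δ : ℝ} {N : Fin d → ℕ} (hN : ¬∀ l, 1 ≤ N l) :
    gridPoints δ N = ∅ := by
  classical
  push Not at hN
  obtain ⟨l, hl⟩ := hN
  rw [gridPoints, Finset.image_eq_empty, Finset.eq_empty_iff_forall_notMem]
  intro k hk
  have := Finset.mem_Icc.1 (Fintype.mem_piFinset.1 hk l)
  omega

end Grid

/-! ### Kernels with partial derivatives along the axes -/

section PartialDerivatives

theorem abs_add_smul_sub_le_of_lineDeriv_le {E : Type*} [AddCommGroup E] [Module ℝ E] {g : E → ℝ}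
    {z v : E} {c M : ℝ} (hg : ∀ s : ℝ, LineDifferentiableAt ℝ g (z + (s * c) • v) v)
    (hM : ∀ s ∈ Set.Icc (0 : ℝ) 1, |lineDeriv ℝ g (z + (s * c) • v) v| ≤ M) :
    |g (z + c • v) - g z| ≤ M * |c| := by
  have hasDerivAt_path : ∀ s : ℝ, HasDerivAt (fun s : ℝ => g (z + (s * c) • v))
      (lineDeriv ℝ g (z + (s * c) • v) v * c) s := by
    intro s
    have hasDerivAt_line : HasDerivAt (fun t : ℝ => g (z + (s * c) • v + t • v))
        (lineDeriv ℝ g (z + (s * c) • v) v) ((s - s) * c) := by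
      rw [sub_self, zero_mul]
      exact (hg s).hasLineDerivAt
    have hasDerivAt_param : HasDerivAt (fun r : ℝ => (r - s) * c) c s := by
      simpa using ((hasDerivAt_id s).sub_const s).mul_const c
    refine (hasDerivAt_line.comp s hasDerivAt_param).congr_of_eventuallyEq
      (Eventually.of_forall fun r => ?_)
    simp only [Function.comp_apply, add_assoc, ← add_smul]
    congr 3
    ring
  have h := norm_image_sub_le_of_norm_deriv_le_segment_01' (C := M * |c|)
    (fun s _ => (hasDerivAt_path s).hasDerivWithinAt) fun s hs => by
      rw [Real.norm_eq_abs, abs_mul]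
      gcongr
      exact hM s ⟨hs.1, hs.2.le⟩
  simpa only [one_mul, zero_mul, zero_smul, add_zero, Real.norm_eq_abs] using h

variable {d : ℕ}

/-- The path from `y` to `x` along the coordinate axes: at time `m` the first `m` coordinates are
those of `x` and the others those of `y`. Kernels are only differentiable along the axes, so the
mean value inequality is applied to the legs of this path. -/
noncomputable def coordPath (x y : Pt d) (m : ℕ) : Pt d :=
  WithLp.toLp 2 fun i => if (i : ℕ) < m then x i else y i

theorem coordPath_zero (x y : Pt d) : coordPath x y 0 = y := by
  ext i
  simp [coordPath]

theorem coordPath_self (x y : Pt d) : coordPath x y d = x := by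
  ext i
  simp [coordPath]

theorem coordPath_succ (x y : Pt d) (i : Fin d) :
    coordPath x y (i + 1) = coordPath x y i + (x i - y i) • EuclideanSpace.single i (1 : ℝ) := by
  ext j
  rcases eq_or_ne j i with rfl | hji
  · simp [coordPath]
  · have : j ≤ i ↔ j < i := by grind
    simp [coordPath, hji, this]

theorem norm_coordPath_zero_add_le (x : Pt d) (i : Fin d) {s : ℝ} (hs : s ∈ Set.Icc (0 : ℝ) 1) :
    ‖coordPath x 0 i + (s * x i) • EuclideanSpace.single i (1 : ℝ)‖ ≤ ‖x‖ := by
  rw [EuclideanSpace.norm_eq, EuclideanSpace.norm_eq]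
  refine Real.sqrt_le_sqrt (Finset.sum_le_sum fun j _ => ?_)
  refine pow_le_pow_left₀ (norm_nonneg _) ?_ 2
  rcases eq_or_ne j i with rfl | hji
  · simpa [coordPath, abs_of_nonneg hs.1] using mul_le_of_le_one_left (abs_nonneg (x j)) hs.2
  · simp only [coordPath, PiLp.add_apply, PiLp.smul_apply, PiLp.zero_apply,
      PiLp.single_apply, hji, if_false, smul_zero, add_zero]
    split_ifs <;> simp

theorem abs_sub_le_of_lineDeriv_single_le {g : Pt d → ℝ} {M : ℝ} (x y : Pt d)
    (hg : ∀ i z, LineDifferentiableAt ℝ g z (EuclideanSpace.single i 1))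
    (hM : ∀ (i : Fin d), ∀ s ∈ Set.Icc (0 : ℝ) 1,
      |lineDeriv ℝ g (coordPath x y i + (s * (x i - y i)) • EuclideanSpace.single i (1 : ℝ))
        (EuclideanSpace.single i 1)| ≤ M) :
    |g x - g y| ≤ d * (M * ‖x - y‖) := by
  have leg_le : ∀ i : Fin d,
      |g (coordPath x y (i + 1)) - g (coordPath x y i)| ≤ M * ‖x - y‖ := by
    intro i
    have hM_nonneg : 0 ≤ M := (abs_nonneg _).trans (hM i 0 ⟨le_rfl, zero_le_one⟩)
    rw [coordPath_succ]
    refine (abs_add_smul_sub_le_of_lineDeriv_le (fun s => hg i _) (hM i)).trans ?_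
    gcongr
    exact PiLp.norm_apply_le (x - y) i
  have telescope : g x - g y = ∑ i : Fin d, (g (coordPath x y (i + 1)) - g (coordPath x y i)) := by
    rw [Fin.sum_univ_eq_sum_range (fun i => g (coordPath x y (i + 1)) - g (coordPath x y i)),
      Finset.sum_range_sub (fun i => g (coordPath x y i)), coordPath_self, coordPath_zero]
  rw [telescope]
  refine (Finset.abs_sum_le_sum_abs _ _).trans ((Finset.sum_le_sum fun i _ => leg_le i).trans ?_)
  simp

theorem exists_abs_sub_zero_le_norm_pow {g : Pt d → ℝ} {k : ℕ}
    (hg : ∀ i z, LineDifferentiableAt ℝ g z (EuclideanSpace.single i 1))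
    (hderiv : ∀ i : Fin d, ∃ M : ℝ, 0 ≤ M ∧
      ∀ x, |lineDeriv ℝ g x (EuclideanSpace.single i 1)| ≤ M * ‖x‖ ^ k) :
    ∃ M : ℝ, 0 ≤ M ∧ ∀ x, |g x - g 0| ≤ M * ‖x‖ ^ (k + 1) := by
  choose M hM_nonneg hM using hderiv
  have sum_nonneg : 0 ≤ ∑ i, M i := Finset.sum_nonneg fun i _ => hM_nonneg i
  refine ⟨d * ∑ i, M i, by positivity, fun x => ?_⟩
  have mean_value := abs_sub_le_of_lineDeriv_single_le (M := (∑ i, M i) * ‖x‖ ^ k) x 0 hg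
    fun i s hs => by
      refine (hM i _).trans ?_
      gcongr
      · exact Finset.single_le_sum (fun i _ => hM_nonneg i) (Finset.mem_univ i)
      · simpa using norm_coordPath_zero_add_le x i hs
  rw [sub_zero] at mean_value
  exact mean_value.trans_eq (by ring)

variable {K : Pt d → ℝ} {lam : ℕ}

theorem KernelFlat.exists_abs_iterPartial_le (hK : KernelFlat K lam) {k : ℕ} (hk : k ≤ lam)
    {l : List (Fin d)} (hl : l.length + k = lam + 1) :
    ∃ M : ℝ, 0 ≤ M ∧ ∀ x, |iterPartial K l x| ≤ M * ‖x‖ ^ k := by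
  induction k generalizing l with
  | zero =>
    obtain ⟨M, hM⟩ := hK.bounded l hl
    exact ⟨M, (abs_nonneg _).trans (hM 0), fun x => by simpa using hM x⟩
  | succ k ih =>
    have taylor := exists_abs_sub_zero_le_norm_pow (hK.exists_partial l (by omega))
      fun i => ih (l := i :: l) (by omega) (by grind)
    simpa only [hK.vanish l (by omega) (by omega), sub_zero] using taylor

theorem KernelFlat.exists_abs_sub_zero_le (hK : KernelFlat K lam) :
    ∃ M : ℝ, 0 ≤ M ∧ ∀ x, |K x - K 0| ≤ M * ‖x‖ ^ (lam + 1) :=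
  exists_abs_sub_zero_le_norm_pow (hK.exists_partial [] (Nat.zero_le _))
    fun i => hK.exists_abs_iterPartial_le (l := [i]) le_rfl (by grind)

theorem KernelFlat.exists_abs_sub_one_le_rpow (hflat : KernelFlat K lam) (hK : KernelAssumption K)
    {β : ℝ} (hβ : 0 < β) (hlamβ : β - 1 < lam) :
    ∃ M : ℝ, 0 ≤ M ∧ ∀ x, |K x - 1| ≤ M * ‖x‖ ^ β := by
  obtain ⟨M, hM_nonneg, hM⟩ := hflat.exists_abs_sub_zero_le
  refine ⟨M + 1, by positivity, fun x => ?_⟩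
  have rpow_nonneg : 0 ≤ ‖x‖ ^ β := by positivity
  rcases le_total ‖x‖ 1 with hx | hx
  · have pow_le_rpow : ‖x‖ ^ (lam + 1) ≤ ‖x‖ ^ β := by
      rw [← Real.rpow_natCast]
      exact Real.rpow_le_rpow_of_exponent_ge' (norm_nonneg x) hx hβ.le (by push_cast; linarith)
    have taylor := hM x
    rw [hK.at_zero] at taylor
    nlinarith
  · have abs_le_one : |K x - 1| ≤ 1 := by
      rw [abs_le]
      constructor <;> linarith [hK.nonneg x, hK.le_one x]
    nlinarith [Real.one_le_rpow hx hβ.le]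

/-- A lag window `K` bounded by one and supported in the closed ball of radius `R`: all that the
variance of the estimator requires of the kernel. -/
structure IsLagWindow (K : Pt d → ℝ) (R : ℝ) : Prop where
  radius_nonneg : 0 ≤ R
  abs_le_one : ∀ x, |K x| ≤ 1
  norm_le : ∀ x, K x ≠ 0 → ‖x‖ ≤ R

theorem KernelAssumption.exists_isLagWindow (hK : KernelAssumption K) :
    ∃ R : ℝ, IsLagWindow K R := by
  obtain ⟨R, hR⟩ := hK.bounded_support.exists_norm_le
  exact ⟨R, (norm_nonneg _).trans (hR 0 hK.zero_mem_support),
    fun x => abs_le.2 ⟨by linarith [hK.nonneg x], hK.le_one x⟩,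
    fun x hx => hR x (lt_of_le_of_ne (hK.nonneg x) hx.symm)⟩

theorem IsLagWindow.norm_le_of_inv_smul_ne_zero {R Δ : ℝ} (hK : IsLagWindow K R) (hΔ : 0 < Δ)
    {h : Pt d} (hne : K (Δ⁻¹ • h) ≠ 0) : ‖h‖ ≤ R * Δ := by
  have scaled_le := hK.norm_le _ hne
  rwa [norm_smul, Real.norm_of_nonneg (by positivity), inv_mul_le_iff₀ hΔ, mul_comm] at scaled_le

theorem lineDeriv_eq_zero_of_norm_gt {E : Type*} [NormedAddCommGroup E] [NormedSpace ℝ E]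
    {g : E → ℝ} {R : ℝ} (hg : ∀ x, g x ≠ 0 → ‖x‖ ≤ R) {x : E} (hx : R < ‖x‖) (v : E) :
    lineDeriv ℝ g x v = 0 := by
  have eventually_zero : g =ᶠ[𝓝 x] fun _ => 0 := by
    filter_upwards [(isOpen_lt continuous_const continuous_norm).mem_nhds hx] with y hy
    by_contra hne
    exact absurd (hg y hne) (not_le.2 hy)
  rw [eventually_zero.lineDeriv_eq]
  simp [lineDeriv]

theorem KernelFlat.exists_lipschitzWith (hflat : KernelFlat K lam) (hK : KernelAssumption K) :
    ∃ M : NNReal, LipschitzWith M K := by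
  obtain ⟨R, hR_nonneg, -, hR⟩ := hK.exists_isLagWindow
  have partial_bounded : ∀ i : Fin d, ∃ M : ℝ, 0 ≤ M ∧ ∀ x, |iterPartial K [i] x| ≤ M := by
    intro i
    obtain ⟨M, hM_nonneg, hM⟩ := hflat.exists_abs_iterPartial_le (l := [i]) le_rfl (by grind)
    refine ⟨M * R ^ lam, by positivity, fun x => ?_⟩
    rcases le_or_gt ‖x‖ R with hx | hx
    · exact (hM x).trans (by gcongr)
    · rw [show iterPartial K [i] x = 0 from lineDeriv_eq_zero_of_norm_gt hR hx _, abs_zero]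
      positivity
  choose M hM_nonneg hM using partial_bounded
  refine ⟨_, LipschitzWith.of_dist_le' (K := d * ∑ i, M i) fun x y => ?_⟩
  rw [Real.dist_eq, dist_eq_norm, mul_assoc]
  exact abs_sub_le_of_lineDeriv_single_le x y (hflat.exists_partial [] (Nat.zero_le _))
    fun i s _ => (hM i _).trans
      (Finset.single_le_sum (fun i _ => hM_nonneg i) (Finset.mem_univ i))

end PartialDerivatives

/-! ### Uniqueness of Fourier transforms -/

section PlaneWave

variable {V : Type*} [NormedAddCommGroup V] [InnerProductSpace ℝ V]

/-- The character `x ↦ e^{i ⟨x, θ⟩}` of frequency `θ`. -/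
noncomputable def planeWave (θ x : V) : ℂ := Complex.exp (Complex.I * ((⟪x, θ⟫_ℝ : ℝ) : ℂ))

theorem norm_planeWave (θ x : V) : ‖planeWave θ x‖ = 1 := by
  rw [planeWave, mul_comm, Complex.norm_exp_ofReal_mul_I]

theorem norm_planeWave_sub_le (θ x y : V) : ‖planeWave θ x - planeWave θ y‖ ≤ ‖x - y‖ * ‖θ‖ := by
  have factor : planeWave θ x - planeWave θ y
      = planeWave θ y * (Complex.exp (Complex.I * ((⟪x - y, θ⟫_ℝ : ℝ) : ℂ)) - 1) := by
    rw [mul_sub, mul_one, planeWave, planeWave, ← Complex.exp_add, inner_sub_left]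
    push_cast
    ring_nf
  rw [factor, norm_mul, norm_planeWave, one_mul]
  exact Real.norm_exp_I_mul_ofReal_sub_one_le.trans (abs_real_inner_le_norm _ _)

theorem continuous_planeWave (θ : V) : Continuous (planeWave θ) := by
  unfold planeWave
  fun_prop

variable [MeasurableSpace V] [BorelSpace V]
  {E : Type*} [NormedAddCommGroup E] [NormedSpace ℂ E] {μ : Measure V} {D : V → E}

theorem integrable_planeWave_smul [SecondCountableTopology V] (hD : Integrable D μ) (θ : V) :
    Integrable (fun x => planeWave θ x • D x) μ := by
  refine hD.norm.mono' ((continuous_planeWave θ).aestronglyMeasurable.smul hD.1) ?_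
  filter_upwards with x
  rw [norm_smul, norm_planeWave, one_mul]

variable [FiniteDimensional ℝ V] [CompleteSpace E]

open FourierTransform in
-- Every test function is the Fourier transform of a Schwartz function, so moving the transform
-- from one factor to the other shows that `D` is orthogonal to all test functions.
theorem ae_eq_zero_of_fourier_eq_zero (hD : Integrable D) (hD_fourier : ∀ ξ, 𝓕 D ξ = 0) :
    D =ᵐ[volume] 0 := by
  refine ae_eq_zero_of_integral_contDiff_smul_eq_zero hD.locallyIntegrable fun g hg hg_supp => ?_
  have hg_supp_ofReal : HasCompactSupport fun x => ((g x : ℝ) : ℂ) :=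
    hg_supp.comp_left (g := Complex.ofReal) rfl
  let φ : SchwartzMap V ℂ :=
    hg_supp_ofReal.toSchwartzMap (Complex.ofRealCLM.contDiff.comp hg)
  have fourier_inv_eq : ∀ x, 𝓕 (𝓕⁻ φ : SchwartzMap V ℂ) x = (g x : ℂ) := fun x => by
    rw [fourier_fourierInv_eq φ]
    rfl
  have flip : ∫ ξ, 𝓕 (𝓕⁻ φ : SchwartzMap V ℂ) ξ • D ξ
      = ∫ x, (𝓕⁻ φ : SchwartzMap V ℂ) x • 𝓕 D x := by
    rw [SchwartzMap.fourier_coe]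
    simpa using! (VectorFourier.integral_fourierIntegral_smul_eq_flip (L := innerₗ V)
      Real.continuous_fourierChar continuous_inner (𝓕⁻ φ : SchwartzMap V ℂ).integrable hD)
  simpa only [hD_fourier, fourier_inv_eq, smul_zero, integral_zero, Complex.coe_smul] using flip

open FourierTransform in
theorem ae_eq_of_integral_planeWave_smul_eq {D' : V → E} (hD : Integrable D)
    (hD' : Integrable D')
    (h : ∀ θ, ∫ x, planeWave θ x • D x = ∫ x, planeWave θ x • D' x) : D =ᵐ[volume] D' := by
  have fourier_sub_eq_zero : ∀ ξ, 𝓕 (D - D') ξ = 0 := by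
    intro ξ
    have hξ : ∫ x, planeWave ((-2 * Real.pi) • ξ) x • (D - D') x = 0 := by
      simp only [Pi.sub_apply, smul_sub]
      rw [integral_sub (integrable_planeWave_smul hD _) (integrable_planeWave_smul hD' _), h,
        sub_self]
    rw [Real.fourier_eq', ← hξ]
    congr with x
    rw [planeWave, inner_smul_right]
    congr 2
    ring
  filter_upwards [ae_eq_zero_of_fourier_eq_zero (hD.sub hD') fourier_sub_eq_zero] with x hx
  exact sub_eq_zero.1 hx

end PlaneWave

section PowerLaw

variable {H : Type*} [NormedAddCommGroup H] [InnerProductSpace ℂ H] [CompleteSpace H]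
  {ι : Type*} {d : ℕ}

theorem ae_eq_of_fourierOp_eq {C C' : Pt d → H →L[ℂ] H} (hC : Integrable C)
    (hC' : Integrable C') (h : ∀ θ, fourierOp C θ = fourierOp C' θ) : C =ᵐ[volume] C' := by
  have scale_ne_zero : ((((2 * Real.pi) ^ d)⁻¹ : ℝ) : ℂ) ≠ 0 := by
    rw [Complex.ofReal_ne_zero]
    positivity
  exact ae_eq_of_integral_planeWave_smul_eq hC hC' fun θ =>
    smul_right_injective (H →L[ℂ] H) scale_ne_zero (h θ)

theorem lintegral_rpow_norm_mul_hsNorm_le_of_mem_powerLawClass {e : HilbertBasis ι ℂ H}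
    {C : Pt d → H →L[ℂ] H} {β L : ℝ} (hC : Integrable C)
    (hf : fourierOp C ∈ powerLawClass e d β L) :
    ∫⁻ x, ENNReal.ofReal (‖x‖ ^ β) * hsNorm e (C x) ≤ ENNReal.ofReal L := by
  obtain ⟨C', hC'_meas, hC'_le, fourierOp_eq⟩ := hf
  have one_le_weight : ∀ x : Pt d, 1 ≤ ENNReal.ofReal (1 + ‖x‖ ^ β) := fun x =>
    ENNReal.one_le_ofReal.2 (le_add_of_nonneg_right (Real.rpow_nonneg (norm_nonneg x) β))
  have hC' : Integrable C' := by
    refine integrable_of_lintegral_traceNorm (e := e) hC'_meas (lt_of_le_of_lt ?_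
      (hC'_le.trans_lt ENNReal.ofReal_lt_top))
    exact lintegral_mono fun x => le_mul_of_one_le_left' (one_le_weight x)
  refine le_trans (lintegral_mono_ae ?_) hC'_le
  filter_upwards [ae_eq_of_fourierOp_eq hC hC' fourierOp_eq] with x hx
  rw [hx]
  exact mul_le_mul' (ENNReal.ofReal_le_ofReal (by linarith)) (hsNorm_le_traceNorm e _)

end PowerLaw

/-! ### Edge corrections -/

section EdgeCorrection

variable {d : ℕ}

/-- The sampling region `T` is a box with upper corner `(Nₗ δ)ₗ` whose lower corner is offset by at
most one mesh width, and it is large in comparison with the largest lag `ρ` in use. Both admissible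
kinds of regions are eventually of this form. -/
structure FineMesh (ρ δ a : ℝ) (N : Fin d → ℕ) (T : Set (Pt d)) : Prop where
  lag_nonneg : 0 ≤ ρ
  mesh_pos : 0 < δ
  mesh_le_one : δ ≤ 1
  diam_cell_lt_one : √d * δ < 1
  offset_nonneg : 0 ≤ a
  offset_le : a ≤ δ
  region_eq : T = closedBox (fun _ => a) fun l => N l * δ
  side_ge : ∀ l, 2 * (ρ + 1) ≤ N l * δ - a

/-- The volume of the overlap of the region `T` with its translate by `-h`. -/
noncomputable def overlap (T : Set (Pt d)) (h : Pt d) : ℝ :=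
  volume.real (T ∩ (fun x => x - h) '' T)

theorem one_add_pow_le_one_add_two_pow_mul {δ : ℝ} (hδ_nonneg : 0 ≤ δ) (hδ_le : δ ≤ 1) (n : ℕ) :
    (1 + δ) ^ n ≤ 1 + 2 ^ n * δ := by
  have sharp : (1 + δ) ^ n ≤ 1 + (2 ^ n - 1) * δ := by
    induction n with
    | zero => simp
    | succ n ih =>
      have one_le : (1 : ℝ) ≤ 2 ^ n := one_le_pow₀ (by norm_num)
      rw [pow_succ, pow_succ]
      nlinarith [mul_nonneg (mul_nonneg (sub_nonneg.2 one_le) hδ_nonneg) (sub_nonneg.2 hδ_le)]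
  linarith

theorem abs_apply_le_of_norm_le {ρ : ℝ} {h : Pt d} (hh : ‖h‖ ≤ ρ) (l : Fin d) : |h l| ≤ ρ :=
  (PiLp.norm_apply_le h l).trans hh

/-- The edge correction at lag `m`: the volume `δ ^ d` per lattice point times the number of pairs
of observations at lag `m`, over the volume of the overlap by which the estimator divides. -/
noncomputable def edgeRatio (δ : ℝ) (N : Fin d → ℕ) (T : Set (Pt d)) (m : Fin d → ℤ) : ℝ :=
  δ ^ d * ((∏ l, ((N l : ℤ) - |m l|).toNat : ℕ) : ℝ) / overlap T (latticePt δ m)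

theorem edgeRatio_eq_zero {δ : ℝ} {N : Fin d → ℕ} {T : Set (Pt d)} {m : Fin d → ℤ}
    (hm : m ∉ Fintype.piFinset fun l => Finset.Icc (-(N l : ℤ)) (N l)) :
    edgeRatio δ N T m = 0 := by
  simp only [Fintype.mem_piFinset, Finset.mem_Icc, not_forall, ← abs_le] at hm
  obtain ⟨l, hl⟩ := hm
  rw [edgeRatio, Finset.prod_eq_zero (Finset.mem_univ l) (Int.toNat_eq_zero.2 (by linarith)),
    Nat.cast_zero, mul_zero, zero_div]

namespace FineMesh

variable {ρ δ a : ℝ} {N : Fin d → ℕ} {T : Set (Pt d)}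

theorem volume_eq (hM : FineMesh ρ δ a N T) : volume.real T = ∏ l, (N l * δ - a) := by
  rw [hM.region_eq, volume_real_closedBox fun l => by linarith [hM.side_ge l, hM.lag_nonneg]]

theorem volume_pos (hM : FineMesh ρ δ a N T) : 0 < volume.real T := by
  rw [hM.volume_eq]
  exact Finset.prod_pos fun l _ => by linarith [hM.side_ge l, hM.lag_nonneg]

theorem overlap_eq (hM : FineMesh ρ δ a N T) {h : Pt d} (hh : ‖h‖ ≤ ρ) :
    overlap T h = ∏ l, (N l * δ - a - |h l|) := by
  rw [overlap, hM.region_eq, volume_real_closedBox_inter_shift]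
  exact fun l => by linarith [hM.side_ge l, abs_apply_le_of_norm_le hh l, hM.lag_nonneg]

theorem volume_div_two_pow_le_overlap (hM : FineMesh ρ δ a N T) {h : Pt d} (hh : ‖h‖ ≤ ρ) :
    volume.real T / 2 ^ d ≤ overlap T h := by
  have two_pow_eq : (2 : ℝ) ^ d = ∏ _l : Fin d, (2 : ℝ) := by simp
  rw [hM.overlap_eq hh, hM.volume_eq, two_pow_eq, ← Finset.prod_div_distrib]
  refine Finset.prod_le_prod (fun l _ => ?_) fun l _ => ?_ <;>
    linarith [hM.side_ge l, abs_apply_le_of_norm_le hh l, hM.lag_nonneg]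

theorem one_le_side_sub_abs (hM : FineMesh ρ δ a N T) {h : Pt d} (hh : ‖h‖ ≤ ρ) (l : Fin d) :
    1 ≤ N l * δ - a - |h l| := by
  linarith [hM.side_ge l, abs_apply_le_of_norm_le hh l, hM.lag_nonneg]

theorem natCast_toNat_sub_abs (hM : FineMesh ρ δ a N T) {m : Fin d → ℤ}
    (hm : ‖latticePt δ m‖ ≤ ρ) (l : Fin d) :
    ((((N l : ℤ) - |m l|).toNat : ℕ) : ℝ) = N l - |(m l : ℝ)| := by
  have scaled_pos : 0 < (N l - |(m l : ℝ)|) * δ := by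
    have side_pos := hM.one_le_side_sub_abs hm l
    rw [latticePt_apply, abs_mul, abs_of_pos hM.mesh_pos] at side_pos
    linarith [hM.offset_nonneg]
  have abs_lt : |(m l : ℝ)| < N l := sub_pos.1 (pos_of_mul_pos_left scaled_pos hM.mesh_pos.le)
  have abs_le : |m l| ≤ (N l : ℤ) := by exact_mod_cast abs_lt.le
  rw [← Int.cast_natCast, Int.toNat_of_nonneg (sub_nonneg.2 abs_le)]
  push_cast
  rfl

theorem edgeRatio_eq_prod (hM : FineMesh ρ δ a N T) {m : Fin d → ℤ}
    (hm : ‖latticePt δ m‖ ≤ ρ) :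
    edgeRatio δ N T m = ∏ l, (1 + a / (N l * δ - a - |latticePt δ m l|)) := by
  have pow_eq : δ ^ d = ∏ _l : Fin d, δ := by simp
  rw [edgeRatio, hM.overlap_eq hm, pow_eq, Nat.cast_prod, ← Finset.prod_mul_distrib,
    ← Finset.prod_div_distrib]
  refine Finset.prod_congr rfl fun l _ => ?_
  rw [hM.natCast_toNat_sub_abs hm, eq_comm,
    one_add_div (by linarith [hM.one_le_side_sub_abs hm l]), latticePt_apply, abs_mul,
    abs_of_pos hM.mesh_pos]
  congr 1
  ring

theorem edgeRatio_mem_Icc (hM : FineMesh ρ δ a N T) {m : Fin d → ℤ}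
    (hm : ‖latticePt δ m‖ ≤ ρ) : edgeRatio δ N T m ∈ Set.Icc 1 (1 + 2 ^ d * δ) := by
  have quotient_nonneg : ∀ l, 0 ≤ a / (N l * δ - a - |latticePt δ m l|) := fun l =>
    div_nonneg hM.offset_nonneg (by linarith [hM.one_le_side_sub_abs hm l])
  have quotient_le : ∀ l, a / (N l * δ - a - |latticePt δ m l|) ≤ δ := fun l =>
    (div_le_self hM.offset_nonneg (hM.one_le_side_sub_abs hm l)).trans hM.offset_le
  rw [hM.edgeRatio_eq_prod hm]
  constructor
  · calc (1 : ℝ) = ∏ _l : Fin d, 1 := by simp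
      _ ≤ ∏ l, (1 + a / (N l * δ - a - |latticePt δ m l|)) := Finset.prod_le_prod
          (fun _ _ => zero_le_one) fun l _ => by linarith [quotient_nonneg l]
  · calc ∏ l, (1 + a / (N l * δ - a - |latticePt δ m l|))
        ≤ ∏ _l : Fin d, (1 + δ) := Finset.prod_le_prod
          (fun l _ => by linarith [quotient_nonneg l]) fun l _ => by linarith [quotient_le l]
      _ = (1 + δ) ^ d := by simp
      _ ≤ 1 + 2 ^ d * δ := one_add_pow_le_one_add_two_pow_mul hM.mesh_pos.le hM.mesh_le_one d

theorem abs_edgeRatio_sub_one_mul_le {R Δ : ℝ} (hM : FineMesh (R * Δ) δ a N T) (hΔ : 0 < Δ)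
    {K : Pt d → ℝ} (hK : IsLagWindow K R) (m : Fin d → ℤ) :
    |(edgeRatio δ N T m - 1) * K (Δ⁻¹ • latticePt δ m)| ≤ 2 ^ d * δ := by
  have hδ := hM.mesh_pos
  by_cases hne : K (Δ⁻¹ • latticePt δ m) = 0
  · rw [hne, mul_zero, abs_zero]
    positivity
  · obtain ⟨one_le, le_one_add⟩ := hM.edgeRatio_mem_Icc (hK.norm_le_of_inv_smul_ne_zero hΔ hne)
    have ratio_le : |edgeRatio δ N T m - 1| ≤ 2 ^ d * δ := by
      rw [abs_of_nonneg (by linarith)]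
      linarith
    calc |(edgeRatio δ N T m - 1) * K (Δ⁻¹ • latticePt δ m)|
        ≤ 2 ^ d * δ * 1 := by
          rw [abs_mul]
          gcongr
          exact hK.abs_le_one _
      _ = 2 ^ d * δ := mul_one _

end FineMesh

end EdgeCorrection

/-! ### The bias -/

section Estimator

open InnerProductSpace (rankOne)

variable {d : ℕ} {H : Type*} [NormedAddCommGroup H] [InnerProductSpace ℂ H]
  {ι Ω : Type*} {X : Pt d → Ω → H} {K : Pt d → ℝ}

/-- The weight of a pair of observations at lag `h` in the estimator. -/
noncomputable def pairWeight (K : Pt d → ℝ) (δ : ℝ) (T : Set (Pt d)) (Δ : ℝ) (θ h : Pt d) : ℂ :=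
  ((δ ^ (2 * d) / (2 * Real.pi) ^ d : ℝ) : ℂ) *
    (planeWave θ h * ((K (Δ⁻¹ • h) / overlap T h : ℝ) : ℂ))

theorem specEstimator_eq_sum {δ : ℝ} (hδ : 0 < δ) (N : Fin d → ℕ) (T : Set (Pt d)) (Δ : ℝ)
    (θ : Pt d) (ω : Ω) :
    specEstimator K X δ N T Δ θ ω
      = ∑ p ∈ gridIdx N ×ˢ gridIdx N, pairWeight K δ T Δ θ (latticePt δ (p.1 - p.2)) •
          rankOne ℂ (X (latticePt δ p.1) ω) (X (latticePt δ p.2) ω) := by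
  rw [specEstimator, sum_gridPoints hδ, Finset.sum_product, Finset.smul_sum]
  refine Finset.sum_congr rfl fun k _ => ?_
  rw [sum_gridPoints hδ, Finset.smul_sum]
  refine Finset.sum_congr rfl fun k' _ => ?_
  rw [smul_smul, latticePt_sub]
  rfl

/-- The factor multiplying `C (latticePt δ m)` in the expected estimator, which is a Riemann sum
for the Fourier integral of `C`. -/
noncomputable def lagMultiplier (K : Pt d → ℝ) (δ : ℝ) (N : Fin d → ℕ) (T : Set (Pt d))
    (Δ : ℝ) (θ : Pt d) (m : Fin d → ℤ) : ℂ :=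
  (edgeRatio δ N T m * K (Δ⁻¹ • latticePt δ m) : ℝ) * planeWave θ (latticePt δ m)

theorem lagMultiplier_eq_zero {δ Δ : ℝ} {N : Fin d → ℕ} {T : Set (Pt d)} {θ : Pt d}
    {m : Fin d → ℤ} (hm : m ∉ Fintype.piFinset fun l => Finset.Icc (-(N l : ℤ)) (N l)) :
    lagMultiplier K δ N T Δ θ m = 0 := by
  rw [lagMultiplier, edgeRatio_eq_zero hm, zero_mul, Complex.ofReal_zero, zero_mul]

namespace FineMesh

variable {R δ Δ a : ℝ} {N : Fin d → ℕ} {T : Set (Pt d)}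

theorem norm_lagMultiplier_le (hM : FineMesh (R * Δ) δ a N T) (hΔ : 0 < Δ)
    (hK : IsLagWindow K R) (θ : Pt d) (m : Fin d → ℤ) :
    ‖lagMultiplier K δ N T Δ θ m‖ ≤ 1 + 2 ^ d := by
  rw [lagMultiplier, norm_mul, norm_planeWave, mul_one, Complex.norm_real, Real.norm_eq_abs]
  calc |edgeRatio δ N T m * K (Δ⁻¹ • latticePt δ m)|
      = |(edgeRatio δ N T m - 1) * K (Δ⁻¹ • latticePt δ m) + K (Δ⁻¹ • latticePt δ m)| := by
        ring_nf
    _ ≤ 2 ^ d * δ + 1 := (abs_add_le _ _).trans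
        (add_le_add (hM.abs_edgeRatio_sub_one_mul_le hΔ hK m) (hK.abs_le_one _))
    _ ≤ 2 ^ d * 1 + 1 := by gcongr; exact hM.mesh_le_one
    _ = 1 + 2 ^ d := by ring

-- The four errors are, in order, the edge correction, the discretisation of the character, the
-- discretisation of the kernel, and the deviation of the kernel from one.
theorem norm_lagMultiplier_sub_planeWave_le (hM : FineMesh (R * Δ) δ a N T) (hΔ : 1 ≤ Δ)
    (hK : IsLagWindow K R) {A : NNReal} (hK_lip : LipschitzWith A K) {B β : ℝ}
    (hK_flat : ∀ x, |K x - 1| ≤ B * ‖x‖ ^ β) {θ : Pt d} {r : ℝ} (hθ : ‖θ‖ ≤ r) (x : Pt d) :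
    ‖lagMultiplier K δ N T Δ θ (cellIdx δ x) - planeWave θ x‖
      ≤ (2 ^ d + √d * r + A * √d) * δ + B * Δ ^ (-β) * ‖x‖ ^ β := by
  have hδ := hM.mesh_pos
  have hΔ_pos : 0 < Δ := one_pos.trans_le hΔ
  set g := latticePt δ (cellIdx δ x)
  have norm_sub_le : ‖g - x‖ ≤ √d * δ := norm_latticePt_cellIdx_sub_le hM.mesh_pos x
  have decomposition : lagMultiplier K δ N T Δ θ (cellIdx δ x) - planeWave θ x
      = ((((edgeRatio δ N T (cellIdx δ x) - 1) * K (Δ⁻¹ • g) : ℝ) : ℂ) * planeWave θ g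
        + ((K (Δ⁻¹ • g) : ℝ) : ℂ) * (planeWave θ g - planeWave θ x))
        + (((K (Δ⁻¹ • g) - K (Δ⁻¹ • x) : ℝ) : ℂ) * planeWave θ x
        + ((K (Δ⁻¹ • x) - 1 : ℝ) : ℂ) * planeWave θ x) := by
    rw [lagMultiplier]; push_cast; ring
  have edge_le : ‖(((edgeRatio δ N T (cellIdx δ x) - 1) * K (Δ⁻¹ • g) : ℝ) : ℂ) * planeWave θ g‖
      ≤ 2 ^ d * δ := by
    rw [norm_mul, norm_planeWave, mul_one, Complex.norm_real]
    exact hM.abs_edgeRatio_sub_one_mul_le hΔ_pos hK _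
  have character_le : ‖((K (Δ⁻¹ • g) : ℝ) : ℂ) * (planeWave θ g - planeWave θ x)‖
      ≤ √d * r * δ := by
    rw [norm_mul, Complex.norm_real, Real.norm_eq_abs]
    calc _ ≤ 1 * (‖g - x‖ * ‖θ‖) := by
          gcongr
          exacts [hK.abs_le_one _, norm_planeWave_sub_le θ g x]
      _ ≤ 1 * ((√d * δ) * r) := by gcongr
      _ = √d * r * δ := by ring
  have kernel_le : ‖((K (Δ⁻¹ • g) - K (Δ⁻¹ • x) : ℝ) : ℂ) * planeWave θ x‖ ≤ A * √d * δ := by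
    rw [norm_mul, norm_planeWave, mul_one, Complex.norm_real, mul_assoc]
    calc _ ≤ A * ‖Δ⁻¹ • g - Δ⁻¹ • x‖ := hK_lip.norm_sub_le _ _
      _ = A * (Δ⁻¹ * ‖g - x‖) := by
          rw [← smul_sub, norm_smul, Real.norm_of_nonneg (by positivity)]
      _ ≤ A * (1 * (√d * δ)) := by gcongr; exact inv_le_one_of_one_le₀ hΔ
      _ = A * (√d * δ) := by rw [one_mul]
  have flatness_le : ‖((K (Δ⁻¹ • x) - 1 : ℝ) : ℂ) * planeWave θ x‖ ≤ B * Δ ^ (-β) * ‖x‖ ^ β := by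
    rw [norm_mul, norm_planeWave, mul_one, Complex.norm_real]
    refine (hK_flat _).trans_eq ?_
    rw [norm_smul, Real.norm_of_nonneg (by positivity),
      Real.mul_rpow (by positivity) (norm_nonneg _), Real.inv_rpow hΔ_pos.le,
      Real.rpow_neg hΔ_pos.le, mul_assoc]
  rw [decomposition]
  linarith [norm_add_le_of_le (norm_add_le_of_le edge_le character_le)
    (norm_add_le_of_le kernel_le flatness_le)]

end FineMesh

variable [CompleteSpace H] [MeasurableSpace Ω] {P : Measure Ω} {e : HilbertBasis ι ℂ H}

theorem IsStationaryRealProcess.integral_specEstimator (hX : IsStationaryRealProcess e P X)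
    {δ : ℝ} (hδ : 0 < δ) (N : Fin d → ℕ) (T : Set (Pt d)) (Δ : ℝ) (θ : Pt d) :
    ∫ ω, specEstimator K X δ N T Δ θ ω ∂P
      = ∑ p ∈ gridIdx N ×ˢ gridIdx N, pairWeight K δ T Δ θ (latticePt δ (p.1 - p.2)) •
          crossCov P (X (latticePt δ p.1)) (X (latticePt δ p.2)) := by
  simp_rw [specEstimator_eq_sum hδ]
  have integrable_summand : ∀ p ∈ gridIdx N ×ˢ gridIdx N, Integrable (fun ω =>
      pairWeight K δ T Δ θ (latticePt δ (p.1 - p.2)) •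
        rankOne ℂ (X (latticePt δ p.1) ω) (X (latticePt δ p.2) ω)) P := fun p _ => by
    have dyad_integrable :=
      integrable_rankOne (hX.memLp_two (latticePt δ p.1)) (hX.memLp_two (latticePt δ p.2))
    exact dyad_integrable.smul (pairWeight K δ T Δ θ (latticePt δ (p.1 - p.2)))
  rw [integral_finsetSum _ integrable_summand]
  refine Finset.sum_congr rfl fun p _ => ?_
  rw [integral_smul]
  rfl

-- Counting the pairs at each lag turns the double sum into a single sum over lags, and a sum over
-- the lattice is the integral of a function constant on the cells.
theorem IsStationaryRealProcess.integral_specEstimator_eq_integral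
    (hX : IsStationaryRealProcess e P X)
    {δ : ℝ} (hδ : 0 < δ) (N : Fin d → ℕ) (T : Set (Pt d)) (Δ : ℝ) (θ : Pt d) :
    ∫ ω, specEstimator K X δ N T Δ θ ω ∂P
      = ((((2 * Real.pi) ^ d)⁻¹ : ℝ) : ℂ) • ∫ x : Pt d,
        lagMultiplier K δ N T Δ θ (cellIdx δ x) • covOp P X (latticePt δ (cellIdx δ x)) := by
  rw [hX.integral_specEstimator hδ, integral_comp_cellIdx (F := fun m =>
    lagMultiplier K δ N T Δ θ m • covOp P X (latticePt δ m)) hδ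
    (Fintype.piFinset fun l => Finset.Icc (-(N l : ℤ)) (N l))
    fun m hm => by rw [lagMultiplier_eq_zero hm, zero_smul], Finset.sum_product]
  simp_rw [hX.crossCov_eq, ← latticePt_sub]
  rw [sum_sum_gridIdx_sub N fun m =>
    pairWeight K δ T Δ θ (latticePt δ m) • covOp P X (latticePt δ m), Finset.smul_sum,
    Finset.smul_sum]
  refine Finset.sum_congr rfl fun m _ => ?_
  rw [← Nat.cast_smul_eq_nsmul ℂ, ← Complex.coe_smul (δ ^ d), smul_smul, smul_smul, smul_smul]
  congr 1
  rw [pairWeight, lagMultiplier, edgeRatio]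
  push_cast
  ring

theorem hsNorm_smul_sub_smul_le {z w : ℂ} (A B : H →L[ℂ] H) :
    hsNorm e (z • A - w • B) ≤ ‖z‖ₑ * hsNorm e (A - B) + ‖z - w‖ₑ * hsNorm e B := by
  have decomposition : z • A - w • B = z • (A - B) + (z - w) • B := by
    rw [smul_sub, sub_smul]
    abel
  rw [decomposition, ← hsNorm_smul, ← hsNorm_smul]
  exact hsNorm_add_le e _ _

theorem hsNorm_fourier_scale_smul_le (A : H →L[ℂ] H) :
    hsNorm e (((((2 * Real.pi) ^ d)⁻¹ : ℝ) : ℂ) • A) ≤ hsNorm e A := by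
  rw [hsNorm_smul]
  refine mul_le_of_le_one_left' ?_
  rw [← ofReal_norm, ENNReal.ofReal_le_one, Complex.norm_real,
    Real.norm_of_nonneg (by positivity)]
  exact inv_le_one_of_one_le₀ (one_le_pow₀ (by linarith [Real.pi_gt_three]))

variable {R δ Δ a : ℝ} {N : Fin d → ℕ} {T : Set (Pt d)}

theorem FineMesh.hsNorm_integral_specEstimator_sub_le_lintegral
    (hM : FineMesh (R * Δ) δ a N T) (hX : IsStationaryRealProcess e P X)
    (hC : Integrable (covOp P X)) (θ : Pt d) :
    hsNorm e ((∫ ω, specEstimator K X δ N T Δ θ ω ∂P) - spectralDensity P X θ)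
      ≤ ∫⁻ x, hsNorm e (lagMultiplier K δ N T Δ θ (cellIdx δ x)
          • covOp P X (latticePt δ (cellIdx δ x)) - planeWave θ x • covOp P X x) := by
  have step_integrable : Integrable fun x : Pt d =>
      lagMultiplier K δ N T Δ θ (cellIdx δ x) • covOp P X (latticePt δ (cellIdx δ x)) :=
    integrable_comp_cellIdx
      (F := fun m => lagMultiplier K δ N T Δ θ m • covOp P X (latticePt δ m)) hM.mesh_pos
      (Fintype.piFinset fun l => Finset.Icc (-(N l : ℤ)) (N l))
      fun m hm => by rw [lagMultiplier_eq_zero hm, zero_smul]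
  have wave_integrable : Integrable fun x : Pt d => planeWave θ x • covOp P X x :=
    integrable_planeWave_smul hC θ
  rw [hX.integral_specEstimator_eq_integral hM.mesh_pos, spectralDensity, fourierOp, ← smul_sub]
  refine (hsNorm_fourier_scale_smul_le _).trans ?_
  change hsNorm e ((∫ x : Pt d, lagMultiplier K δ N T Δ θ (cellIdx δ x)
    • covOp P X (latticePt δ (cellIdx δ x))) - ∫ x : Pt d, planeWave θ x • covOp P X x) ≤ _
  rw [← integral_sub step_integrable wave_integrable]
  exact hsNorm_integral_le e _

theorem FineMesh.hsNorm_integral_specEstimator_sub_le [Countable ι]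
    (hM : FineMesh (R * Δ) δ a N T) (hΔ : 1 ≤ Δ) (hX : IsStationaryRealProcess e P X)
    (hC : Integrable (covOp P X)) (hK : IsLagWindow K R) {A : NNReal} (hK_lip : LipschitzWith A K)
    {B β : ℝ} (hB : 0 ≤ B) (hK_flat : ∀ x, |K x - 1| ≤ B * ‖x‖ ^ β)
    {θ : Pt d} {r : ℝ} (hθ : ‖θ‖ ≤ r) :
    hsNorm e ((∫ ω, specEstimator K X δ N T Δ θ ω ∂P) - spectralDensity P X θ)
      ≤ ENNReal.ofReal (1 + 2 ^ d) * (∫⁻ x, hsNorm e (covOp P X (latticePt δ (cellIdx δ x))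
            - covOp P X x))
        + (ENNReal.ofReal ((2 ^ d + √d * r + A * √d) * δ) * (∫⁻ x, hsNorm e (covOp P X x))
        + ENNReal.ofReal (B * Δ ^ (-β)) *
            ∫⁻ x, ENNReal.ofReal (‖x‖ ^ β) * hsNorm e (covOp P X x)) := by
  have hδ := hM.mesh_pos
  have hΔ_pos : 0 < Δ := one_pos.trans_le hΔ
  have hr : 0 ≤ r := (norm_nonneg θ).trans hθ
  have pointwise : ∀ x, hsNorm e (lagMultiplier K δ N T Δ θ (cellIdx δ x)
          • covOp P X (latticePt δ (cellIdx δ x)) - planeWave θ x • covOp P X x)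
      ≤ ENNReal.ofReal (1 + 2 ^ d) * hsNorm e (covOp P X (latticePt δ (cellIdx δ x)) - covOp P X x)
        + (ENNReal.ofReal ((2 ^ d + √d * r + A * √d) * δ) * hsNorm e (covOp P X x)
        + ENNReal.ofReal (B * Δ ^ (-β)) * (ENNReal.ofReal (‖x‖ ^ β) * hsNorm e (covOp P X x))) := by
    intro x
    refine (hsNorm_smul_sub_smul_le _ _).trans ?_
    rw [← mul_assoc (ENNReal.ofReal (B * Δ ^ (-β))), ← add_mul, ← ENNReal.ofReal_mul
      (by positivity), ← ENNReal.ofReal_add (by positivity) (by positivity), ← ofReal_norm,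
      ← ofReal_norm]
    gcongr
    exacts [hM.norm_lagMultiplier_le hΔ_pos hK θ _,
      hM.norm_lagMultiplier_sub_planeWave_le hΔ hK hK_lip hK_flat hθ x]
  have norm_measurable : AEMeasurable (fun x => hsNorm e (covOp P X x)) volume :=
    aemeasurable_hsNorm e hC.1
  have moment_measurable : AEMeasurable (fun x : Pt d => ENNReal.ofReal (B * Δ ^ (-β)) *
      (ENNReal.ofReal (‖x‖ ^ β) * hsNorm e (covOp P X x))) volume :=
    (AEMeasurable.mul (by fun_prop) norm_measurable).const_mul _
  have sum_measurable : AEMeasurable (fun x : Pt d =>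
      ENNReal.ofReal ((2 ^ d + √d * r + A * √d) * δ) * hsNorm e (covOp P X x)
        + ENNReal.ofReal (B * Δ ^ (-β)) * (ENNReal.ofReal (‖x‖ ^ β) * hsNorm e (covOp P X x)))
      volume := (norm_measurable.const_mul _).add moment_measurable
  refine (hM.hsNorm_integral_specEstimator_sub_le_lintegral hX hC θ).trans
    ((lintegral_mono pointwise).trans_eq ?_)
  rw [lintegral_add_right' _ sum_measurable,
    lintegral_add_right' _ moment_measurable]
  simp only [lintegral_const_mul' _ _ ENNReal.ofReal_ne_top]

end Estimator

/-! ### The variance -/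

section PairSums

variable {G : Type*} [AddGroup G]

theorem sum_comp_sub_right_le_tsum (S : Finset G) (F : G → ℝ≥0∞) (s : G) :
    ∑ t ∈ S, F (t - s) ≤ ∑' m, F m :=
  (ENNReal.sum_le_tsum S).trans_eq ((Equiv.subRight s).tsum_eq F)

theorem sum_comp_sub_left_le_tsum (S : Finset G) (F : G → ℝ≥0∞) (s : G) :
    ∑ t ∈ S, F (s - t) ≤ ∑' m, F m :=
  (ENNReal.sum_le_tsum S).trans_eq ((Equiv.subLeft s).tsum_eq F)

theorem sum_product_comp_sub_le (S : Finset G) (F : G → ℝ≥0∞) :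
    ∑ p ∈ S ×ˢ S, F (p.1 - p.2) ≤ S.card * ∑' m, F m := by
  rw [Finset.sum_product]
  refine (Finset.sum_le_sum fun s _ => sum_comp_sub_left_le_tsum S F s).trans_eq ?_
  rw [Finset.sum_const, nsmul_eq_mul]

theorem sum_product_mul_comp_sub_le (S : Finset G) (F : G → ℝ≥0∞) (s t : G) :
    ∑ q ∈ S ×ˢ S, F (q.1 - s) * F (t - q.2) ≤ (∑' m, F m) ^ 2 := by
  rw [Finset.sum_product, ← Finset.sum_mul_sum S S (fun k => F (k - s)) (fun k => F (t - k)), sq]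
  exact mul_le_mul' (sum_comp_sub_right_le_tsum S F s) (sum_comp_sub_left_le_tsum S F t)

theorem sum_product_comp_sub_comp_sub_le (S : Finset G) (F : G → G → ℝ≥0∞) (s : G) :
    ∑ p ∈ S ×ˢ S, F (p.1 - s) (p.2 - s) ≤ ∑' u, ∑' v, F u v := by
  rw [Finset.sum_product]
  exact (Finset.sum_le_sum fun k _ => sum_comp_sub_right_le_tsum S (F (k - s)) s).trans
    (sum_comp_sub_right_le_tsum S (fun u => ∑' v, F u v) s)

theorem sum_product_mul_le_of_le {f g : G × G → ℝ≥0∞} {b : G → ℝ≥0∞} {c : ℝ≥0∞} {S : Finset G}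
    (hf : ∀ p, f p ≤ b (p.1 - p.2)) (hg : ∀ p, g p ≤ c) :
    ∑ p ∈ S ×ˢ S, f p * g p ≤ S.card * (∑' m, b m) * c :=
  calc ∑ p ∈ S ×ˢ S, f p * g p
      ≤ ∑ p ∈ S ×ˢ S, b (p.1 - p.2) * c :=
        Finset.sum_le_sum fun p _ => mul_le_mul' (hf p) (hg p)
    _ ≤ S.card * (∑' m, b m) * c := by
        rw [← Finset.sum_mul]
        gcongr
        exact sum_product_comp_sub_le S b

-- In the first term the sum over `p` is taken first and `b (p.1 - p.2)` is discarded; in the other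
-- two the sum over `q` is taken first and `b (q.1 - q.2)` is discarded.
theorem sum_sum_pairs_le (S : Finset G) {b : G → ℝ≥0∞} (ρ : G → ℝ≥0∞) (hb : ∀ m, b m ≤ 1)
    {κ : G → G → G → ℝ≥0∞} {Γ : ℝ≥0∞} (hκ : ∀ w, ∑' u, ∑' v, κ u v w ≤ Γ) :
    ∑ p ∈ S ×ˢ S, ∑ q ∈ S ×ˢ S, b (p.1 - p.2) * b (q.1 - q.2) *
        (κ (p.1 - q.2) (p.2 - q.2) (q.1 - q.2) + ρ (q.1 - p.1) * ρ (p.2 - q.2)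
          + ρ (p.1 - q.2) * ρ (q.1 - p.2))
      ≤ S.card * (∑' m, b m) * (Γ + 2 * (∑' m, ρ m) ^ 2) := by
  have cumulant_part : ∑ p ∈ S ×ˢ S, ∑ q ∈ S ×ˢ S,
      b (q.1 - q.2) * κ (p.1 - q.2) (p.2 - q.2) (q.1 - q.2) ≤ S.card * (∑' m, b m) * Γ := by
    rw [Finset.sum_comm]
    simp_rw [← Finset.mul_sum]
    exact sum_product_mul_le_of_le (fun _ => le_rfl) fun q =>
      (sum_product_comp_sub_comp_sub_le S (fun u v => κ u v (q.1 - q.2)) q.2).trans (hκ _)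
  have product_part : ∀ f g : G × G → G, ∑ p ∈ S ×ˢ S, ∑ q ∈ S ×ˢ S,
      b (p.1 - p.2) * (ρ (q.1 - f p) * ρ (g p - q.2)) ≤ S.card * (∑' m, b m) * (∑' m, ρ m) ^ 2 := by
    intro f g
    simp_rw [← Finset.mul_sum]
    exact sum_product_mul_le_of_le (fun _ => le_rfl) fun p => sum_product_mul_comp_sub_le S ρ _ _
  calc _ ≤ ∑ p ∈ S ×ˢ S, ∑ q ∈ S ×ˢ S,
        (b (q.1 - q.2) * κ (p.1 - q.2) (p.2 - q.2) (q.1 - q.2)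
          + b (p.1 - p.2) * (ρ (q.1 - p.1) * ρ (p.2 - q.2))
          + b (p.1 - p.2) * (ρ (q.1 - p.2) * ρ (p.1 - q.2))) := by
        refine Finset.sum_le_sum fun p _ => Finset.sum_le_sum fun q _ => ?_
        rw [mul_add, mul_add, mul_comm (ρ (p.1 - q.2))]
        gcongr
        exacts [mul_le_of_le_one_left' (hb _), mul_le_of_le_one_right' (hb _),
          mul_le_of_le_one_right' (hb _)]
    _ ≤ S.card * (∑' m, b m) * Γ + S.card * (∑' m, b m) * (∑' m, ρ m) ^ 2
        + S.card * (∑' m, b m) * (∑' m, ρ m) ^ 2 := by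
        simp_rw [Finset.sum_add_distrib]
        exact add_le_add (add_le_add cumulant_part (product_part Prod.fst Prod.snd))
          (product_part Prod.snd Prod.fst)
    _ = S.card * (∑' m, b m) * (Γ + 2 * (∑' m, ρ m) ^ 2) := by ring

end PairSums

section Variance

variable {d : ℕ}

/-- The lattice points of norm at most `r`, by their indices: the lags that a kernel of bounded
support retains. -/
def lagBall (δ r : ℝ) : Set (Fin d → ℤ) := {m | ‖latticePt δ m‖ ≤ r}

theorem tsum_indicator_lagBall_le {δ r r' : ℝ} (hδ : 0 < δ) (hr : r + √d * δ ≤ r') (hr' : 0 ≤ r') :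
    ENNReal.ofReal (δ ^ d) * ∑' m : Fin d → ℤ, (lagBall δ r).indicator 1 m
      ≤ ENNReal.ofReal (r' ^ d) * volume (Metric.closedBall (0 : Pt d) 1) := by
  have cell_subset : {x : Pt d | cellIdx δ x ∈ lagBall δ r} ⊆ Metric.closedBall 0 r' := by
    intro x hx
    have corner_le : ‖latticePt δ (cellIdx δ x)‖ ≤ r := hx
    rw [mem_closedBall_zero_iff]
    linarith [norm_le_norm_add_norm_sub' x (latticePt δ (cellIdx δ x)),
      norm_sub_rev x (latticePt δ (cellIdx δ x)), norm_latticePt_cellIdx_sub_le hδ x]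
  calc ENNReal.ofReal (δ ^ d) * ∑' m : Fin d → ℤ, (lagBall δ r).indicator 1 m
      = ∫⁻ x : Pt d, (lagBall δ r).indicator 1 (cellIdx δ x) :=
        (lintegral_comp_cellIdx hδ _).symm
    _ ≤ ∫⁻ x : Pt d, (Metric.closedBall (0 : Pt d) r').indicator 1 x :=
        lintegral_mono (Set.indicator_le_indicator_of_subset cell_subset fun _ => zero_le)
    _ = volume (Metric.closedBall (0 : Pt d) r') := lintegral_indicator_one measurableSet_closedBall
    _ = ENNReal.ofReal (r' ^ d) * volume (Metric.closedBall (0 : Pt d) 1) := by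
        rw [Measure.addHaar_closedBall' _ _ hr', finrank_euclideanSpace_fin]

variable {H : Type*} [NormedAddCommGroup H] [InnerProductSpace ℂ H] [CompleteSpace H]
  {ι Ω : Type*} [MeasurableSpace Ω] {P : Measure Ω} {e : HilbertBasis ι ℂ H}
  {X : Pt d → Ω → H} {K : Pt d → ℝ}

theorem tsum_weakTraceNorm_latticePt_le [Countable ι] {C : Pt d → H →L[ℂ] H} {δ : ℝ} (hδ : 0 < δ)
    (hC : AEStronglyMeasurable C volume) :
    ENNReal.ofReal (δ ^ d) * ∑' m : Fin d → ℤ, weakTraceNorm e (C (latticePt δ m))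
      ≤ (∫⁻ x, weakTraceNorm e (C x))
        + ∫⁻ x, traceNorm e (C (latticePt δ (cellIdx δ x)) - C x) := by
  rw [← lintegral_comp_cellIdx hδ fun m => weakTraceNorm e (C (latticePt δ m)),
    ← lintegral_add_left' (aemeasurable_weakTraceNorm e hC)]
  refine lintegral_mono fun x => ?_
  calc weakTraceNorm e (C (latticePt δ (cellIdx δ x)))
      = weakTraceNorm e (C x + (C (latticePt δ (cellIdx δ x)) - C x)) := by
        rw [add_sub_cancel]
    _ ≤ weakTraceNorm e (C x) + traceNorm e (C (latticePt δ (cellIdx δ x)) - C x) :=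
        (weakTraceNorm_add_le e _ _).trans (add_le_add_right (weakTraceNorm_le_traceNorm e _) _)

/-- The quantity required to be finite in the fourth-order cumulant condition, for the radius
`ε`. -/
noncomputable def cumulantMass (e : HilbertBasis ι ℂ H) (P : Measure Ω) (X : Pt d → Ω → H)
    (ε : ℝ) : ℝ≥0∞ :=
  ⨆ w : Pt d, ∫⁻ u : Pt d, ∫⁻ v : Pt d,
    ⨆ l₁ ∈ Metric.ball (0 : Pt d) ε, ⨆ l₂ ∈ Metric.ball (0 : Pt d) ε,
      ⨆ l₃ ∈ Metric.ball (0 : Pt d) ε,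
        ‖cum4 e P (X (l₁ + u)) (X (l₂ + v)) (X (l₃ + w)) (X 0)‖ₑ

theorem tsum_tsum_cum4_le_cumulantMass {δ ε : ℝ} (hδ : 0 < δ) (hε : √d * δ < ε) (w : Pt d) :
    ∑' u : Fin d → ℤ, ∑' v : Fin d → ℤ, ENNReal.ofReal (δ ^ d) ^ 2 *
        ‖cum4 e P (X (latticePt δ u)) (X (latticePt δ v)) (X w) (X 0)‖ₑ
      ≤ cumulantMass e P X ε := by
  have tsum_eq_lintegral : ∑' u : Fin d → ℤ, ∑' v : Fin d → ℤ, ENNReal.ofReal (δ ^ d) ^ 2 *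
        ‖cum4 e P (X (latticePt δ u)) (X (latticePt δ v)) (X w) (X 0)‖ₑ
      = ∫⁻ x : Pt d, ∫⁻ y : Pt d, ‖cum4 e P (X (latticePt δ (cellIdx δ x)))
          (X (latticePt δ (cellIdx δ y))) (X w) (X 0)‖ₑ := by
    simp_rw [fun x : Pt d => lintegral_comp_cellIdx hδ fun v => ‖cum4 e P
      (X (latticePt δ (cellIdx δ x))) (X (latticePt δ v)) (X w) (X 0)‖ₑ]
    rw [lintegral_comp_cellIdx hδ fun u => ENNReal.ofReal (δ ^ d) * ∑' v, ‖cum4 e P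
      (X (latticePt δ u)) (X (latticePt δ v)) (X w) (X 0)‖ₑ]
    simp_rw [ENNReal.tsum_mul_left, sq, mul_assoc]
  have shift_mem : ∀ x : Pt d, latticePt δ (cellIdx δ x) - x ∈ Metric.ball (0 : Pt d) ε := fun x =>
    mem_ball_zero_iff.2 ((norm_latticePt_cellIdx_sub_le hδ x).trans_lt hε)
  have zero_mem : (0 : Pt d) ∈ Metric.ball (0 : Pt d) ε :=
    Metric.mem_ball_self (lt_of_le_of_lt (by positivity) hε)
  rw [tsum_eq_lintegral]
  refine le_iSup_of_le w (lintegral_mono fun x => lintegral_mono fun y => ?_)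
  refine le_iSup₂_of_le _ (shift_mem x) <| le_iSup₂_of_le _ (shift_mem y) <|
    le_iSup₂_of_le 0 zero_mem ?_
  rw [sub_add_cancel, sub_add_cancel, zero_add]

namespace FineMesh

theorem enorm_pairWeight_le {R δ Δ a : ℝ} {N : Fin d → ℕ} {T : Set (Pt d)}
    (hM : FineMesh (R * Δ) δ a N T) (hΔ : 0 < Δ) (hK : IsLagWindow K R) (θ : Pt d)
    (m : Fin d → ℤ) :
    ‖pairWeight K δ T Δ θ (latticePt δ m)‖ₑ
      ≤ ENNReal.ofReal (δ ^ d) ^ 2 * ENNReal.ofReal (2 ^ d / volume.real T)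
        * (lagBall δ (R * Δ)).indicator 1 m := by
  have hδ := hM.mesh_pos
  have volume_pos := hM.volume_pos
  by_cases hne : K (Δ⁻¹ • latticePt δ m) = 0
  · simp [pairWeight, hne]
  have norm_le := hK.norm_le_of_inv_smul_ne_zero hΔ hne
  have overlap_ge := hM.volume_div_two_pow_le_overlap norm_le
  have overlap_pos : 0 < overlap T (latticePt δ m) := lt_of_lt_of_le (by positivity) overlap_ge
  rw [Set.indicator_of_mem (show m ∈ lagBall δ (R * Δ) from norm_le), Pi.one_apply, mul_one,
    ← ENNReal.ofReal_pow (by positivity), ← ENNReal.ofReal_mul (by positivity), ← ofReal_norm]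
  refine ENNReal.ofReal_le_ofReal ?_
  rw [pairWeight, norm_mul, norm_mul, norm_planeWave, one_mul, Complex.norm_real,
    Complex.norm_real, Real.norm_of_nonneg (by positivity), Real.norm_eq_abs, abs_div,
    abs_of_pos overlap_pos]
  refine mul_le_mul ?_ ?_ (by positivity) (by positivity)
  · rw [← pow_mul, mul_comm d 2]
    exact div_le_self (by positivity) (one_le_pow₀ (by linarith [Real.pi_gt_three]))
  · calc |K (Δ⁻¹ • latticePt δ m)| / overlap T (latticePt δ m)
        ≤ 1 / (volume.real T / 2 ^ d) := by gcongr; exact hK.abs_le_one _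
      _ = 2 ^ d / volume.real T := one_div_div _ _

theorem card_gridIdx_le {ρ δ a : ℝ} {N : Fin d → ℕ} {T : Set (Pt d)} (hM : FineMesh ρ δ a N T) :
    ENNReal.ofReal (δ ^ d) * (gridIdx N).card ≤ ENNReal.ofReal (2 ^ d * volume.real T) := by
  have hδ := hM.mesh_pos
  rw [← ENNReal.ofReal_natCast, ← ENNReal.ofReal_mul (by positivity)]
  refine ENNReal.ofReal_le_ofReal ?_
  calc δ ^ d * ((gridIdx N).card : ℝ) = ∏ l, δ * (N l : ℝ) := by
        simp [gridIdx, Finset.prod_mul_distrib]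
    _ ≤ ∏ l, 2 * (N l * δ - a) := Finset.prod_le_prod (fun l _ => by positivity) fun l _ => by
        linarith [hM.side_ge l, hM.lag_nonneg, hM.offset_le, hM.mesh_le_one]
    _ = 2 ^ d * volume.real T := by simp [hM.volume_eq, Finset.prod_mul_distrib]

end FineMesh

open InnerProductSpace (rankOne)

theorem IsStationaryRealProcess.enorm_hsCov_latticePt_le [Countable ι]
    (hX : IsStationaryRealProcess e P X) (hV : CumulantAssumption e P X) (δ : ℝ)
    (p q : (Fin d → ℤ) × (Fin d → ℤ)) :
    ‖hsCov e P (fun ω => rankOne ℂ (X (latticePt δ p.1) ω) (X (latticePt δ p.2) ω))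
        (fun ω => rankOne ℂ (X (latticePt δ q.1) ω) (X (latticePt δ q.2) ω))‖ₑ
      ≤ ‖cum4 e P (X (latticePt δ (p.1 - q.2))) (X (latticePt δ (p.2 - q.2)))
          (X (latticePt δ (q.1 - q.2))) (X 0)‖ₑ
        + weakTraceNorm e (covOp P X (latticePt δ (q.1 - p.1)))
          * weakTraceNorm e (covOp P X (latticePt δ (p.2 - q.2)))
        + weakTraceNorm e (covOp P X (latticePt δ (p.1 - q.2)))
          * weakTraceNorm e (covOp P X (latticePt δ (q.1 - p.2))) := by
  have shifted := hV.cum_shift (latticePt δ (p.1 - q.2)) (latticePt δ (p.2 - q.2))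
    (latticePt δ (q.1 - q.2)) 0 (latticePt δ q.2)
  rw [← shifted]
  simp only [latticePt_sub, sub_add_cancel, zero_add]
  exact hX.enorm_hsCov_rankOne_le _ _ _ _

theorem IsStationaryRealProcess.lintegral_hsNorm_sq_specEstimator_sub_le_sum
    [IsProbabilityMeasure P] [Countable ι] (hX : IsStationaryRealProcess e P X)
    (hV : CumulantAssumption e P X) {δ : ℝ} (hδ : 0 < δ) (N : Fin d → ℕ) (T : Set (Pt d)) (Δ : ℝ)
    (θ : Pt d) :
    ∫⁻ ω, hsNorm e (specEstimator K X δ N T Δ θ ω - ∫ ω, specEstimator K X δ N T Δ θ ω ∂P) ^ 2 ∂P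
      ≤ ∑ p ∈ gridIdx N ×ˢ gridIdx N, ∑ q ∈ gridIdx N ×ˢ gridIdx N,
        ‖pairWeight K δ T Δ θ (latticePt δ (p.1 - p.2))‖ₑ *
        ‖pairWeight K δ T Δ θ (latticePt δ (q.1 - q.2))‖ₑ *
        ‖hsCov e P (fun ω => rankOne ℂ (X (latticePt δ p.1) ω) (X (latticePt δ p.2) ω))
          (fun ω => rankOne ℂ (X (latticePt δ q.1) ω) (X (latticePt δ q.2) ω))‖ₑ := by
  rw [hX.integral_specEstimator hδ]
  simp_rw [specEstimator_eq_sum hδ, ← Finset.sum_sub_distrib, ← smul_sub]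
  exact lintegral_hsNorm_sq_sum_centred_le (gridIdx N ×ˢ gridIdx N)
    (fun p => pairWeight K δ T Δ θ (latticePt δ (p.1 - p.2)))
    fun p => memHSTwo_rankOne (hV.memLp_four (latticePt δ p.1)) (hV.memLp_four (latticePt δ p.2))

variable [IsProbabilityMeasure P] [Countable ι] {R δ Δ a ε : ℝ} {N : Fin d → ℕ} {T : Set (Pt d)}

namespace FineMesh

-- Each of the four lattice sums absorbs one of the four factors `δ ^ d` in the weights.
theorem lintegral_hsNorm_sq_specEstimator_sub_le_tsum
    (hM : FineMesh (R * Δ) δ a N T) (hΔ : 0 < Δ) (hX : IsStationaryRealProcess e P X)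
    (hV : CumulantAssumption e P X) (hε : √d * δ < ε) (hK : IsLagWindow K R) (θ : Pt d) :
    ∫⁻ ω, hsNorm e (specEstimator K X δ N T Δ θ ω - ∫ ω, specEstimator K X δ N T Δ θ ω ∂P) ^ 2 ∂P
      ≤ ENNReal.ofReal (2 ^ d / volume.real T) ^ 2
        * (ENNReal.ofReal (δ ^ d) * (gridIdx N).card)
        * (ENNReal.ofReal (δ ^ d) * ∑' m : Fin d → ℤ, (lagBall δ (R * Δ)).indicator 1 m)
        * (cumulantMass e P X ε + 2 * (ENNReal.ofReal (δ ^ d) *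
          ∑' m : Fin d → ℤ, weakTraceNorm e (covOp P X (latticePt δ m))) ^ 2) := by
  set D := ENNReal.ofReal (δ ^ d)
  set V := ENNReal.ofReal (2 ^ d / volume.real T)
  set b : (Fin d → ℤ) → ℝ≥0∞ := (lagBall δ (R * Δ)).indicator 1
  set ρ : (Fin d → ℤ) → ℝ≥0∞ := fun m => D * weakTraceNorm e (covOp P X (latticePt δ m))
  set κ : (Fin d → ℤ) → (Fin d → ℤ) → (Fin d → ℤ) → ℝ≥0∞ := fun u v w => D ^ 2 *
    ‖cum4 e P (X (latticePt δ u)) (X (latticePt δ v)) (X (latticePt δ w)) (X 0)‖ₑ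
  have summand_le : ∀ p q : (Fin d → ℤ) × (Fin d → ℤ),
      ‖pairWeight K δ T Δ θ (latticePt δ (p.1 - p.2))‖ₑ *
        ‖pairWeight K δ T Δ θ (latticePt δ (q.1 - q.2))‖ₑ *
        ‖hsCov e P (fun ω => rankOne ℂ (X (latticePt δ p.1) ω) (X (latticePt δ p.2) ω))
          (fun ω => rankOne ℂ (X (latticePt δ q.1) ω) (X (latticePt δ q.2) ω))‖ₑ
      ≤ (D * V) ^ 2 * (b (p.1 - p.2) * b (q.1 - q.2) *
        (κ (p.1 - q.2) (p.2 - q.2) (q.1 - q.2) + ρ (q.1 - p.1) * ρ (p.2 - q.2)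
          + ρ (p.1 - q.2) * ρ (q.1 - p.2))) := fun p q =>
    (mul_le_mul' (mul_le_mul' (hM.enorm_pairWeight_le hΔ hK θ _)
      (hM.enorm_pairWeight_le hΔ hK θ _)) (hX.enorm_hsCov_latticePt_le hV δ p q)).trans_eq
      (by simp only [κ, ρ]; ring)
  have b_le_one : ∀ m, b m ≤ 1 := Set.indicator_le_self' fun _ _ => zero_le
  calc _ ≤ ∑ p ∈ gridIdx N ×ˢ gridIdx N, ∑ q ∈ gridIdx N ×ˢ gridIdx N, (D * V) ^ 2 *
        (b (p.1 - p.2) * b (q.1 - q.2) * (κ (p.1 - q.2) (p.2 - q.2) (q.1 - q.2)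
          + ρ (q.1 - p.1) * ρ (p.2 - q.2) + ρ (p.1 - q.2) * ρ (q.1 - p.2))) :=
        (hX.lintegral_hsNorm_sq_specEstimator_sub_le_sum hV hM.mesh_pos N T Δ θ).trans
          (Finset.sum_le_sum fun p _ => Finset.sum_le_sum fun q _ => summand_le p q)
    _ ≤ (D * V) ^ 2 * ((gridIdx N).card * (∑' m, b m) *
        (cumulantMass e P X ε + 2 * (∑' m, ρ m) ^ 2)) := by
        simp_rw [← Finset.mul_sum]
        gcongr
        exact sum_sum_pairs_le (gridIdx N) ρ b_le_one fun w =>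
          tsum_tsum_cum4_le_cumulantMass hM.mesh_pos hε (latticePt δ w)
    _ = _ := by rw [ENNReal.tsum_mul_left]; ring

theorem lintegral_hsNorm_sq_specEstimator_sub_le
    (hM : FineMesh (R * Δ) δ a N T) (hΔ : 1 ≤ Δ) (hX : IsStationaryRealProcess e P X)
    (hC : AEStronglyMeasurable (covOp P X) volume) (hV : CumulantAssumption e P X)
    (hε : √d * δ < ε) (hK : IsLagWindow K R) (θ : Pt d) :
    ∫⁻ ω, hsNorm e (specEstimator K X δ N T Δ θ ω - ∫ ω, specEstimator K X δ N T Δ θ ω ∂P) ^ 2 ∂P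
      ≤ ENNReal.ofReal (2 ^ (3 * d) * (R + 1) ^ d * (Δ ^ d / volume.real T)) *
        (volume (Metric.closedBall (0 : Pt d) 1) *
        (cumulantMass e P X ε + 2 * ((∫⁻ x, weakTraceNorm e (covOp P X x)) + ∫⁻ x, traceNorm e
            (covOp P X (latticePt δ (cellIdx δ x)) - covOp P X x)) ^ 2)) := by
  have hR := hK.radius_nonneg
  have hΔ_pos : 0 < Δ := one_pos.trans_le hΔ
  have volume_pos := hM.volume_pos
  have lag_sum_le := tsum_indicator_lagBall_le (d := d) (r := R * Δ) (r' := (R + 1) * Δ)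
    hM.mesh_pos (by linarith [hM.diam_cell_lt_one]) (by positivity)
  have const_eq : ENNReal.ofReal (2 ^ d / volume.real T) ^ 2
      * ENNReal.ofReal (2 ^ d * volume.real T) * ENNReal.ofReal (((R + 1) * Δ) ^ d)
      = ENNReal.ofReal (2 ^ (3 * d) * (R + 1) ^ d * (Δ ^ d / volume.real T)) := by
    rw [← ENNReal.ofReal_pow (by positivity), ← ENNReal.ofReal_mul (by positivity),
      ← ENNReal.ofReal_mul (by positivity), mul_pow, pow_mul']
    congr 1
    field_simp
  refine (hM.lintegral_hsNorm_sq_specEstimator_sub_le_tsum hΔ_pos hX hV hε hK θ).trans ?_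
  refine (mul_le_mul' (mul_le_mul' (mul_le_mul' le_rfl hM.card_gridIdx_le) lag_sum_le)
    (add_le_add_right (mul_le_mul' le_rfl (pow_le_pow_left'
      (tsum_weakTraceNorm_latticePt_le hM.mesh_pos hC) 2)) _)).trans_eq ?_
  rw [← const_eq]
  ring

end FineMesh

end Variance

/-! ### Asymptotics of the sampling region -/

section SamplingRegion

theorem dist_le_of_hausdorffEDist_lt {E : Type*} [PseudoMetricSpace E] {s t : Set E} {D r : ℝ}
    (ht : ∀ x ∈ t, ∀ y ∈ t, dist x y ≤ D)
    (hst : Metric.hausdorffEDist s t < ENNReal.ofReal r) {x y : E} (hx : x ∈ s) (hy : y ∈ s) :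
    dist x y ≤ D + 2 * r := by
  obtain ⟨x', hx', hxx'⟩ := Metric.exists_edist_lt_of_hausdorffEDist_lt hx hst
  obtain ⟨y', hy', hyy'⟩ := Metric.exists_edist_lt_of_hausdorffEDist_lt hy hst
  rw [edist_lt_ofReal] at hxx' hyy'
  linarith [dist_triangle4_right x y x' y', ht x' hx' y' hy']

theorem le_pow_mul_of_prod_eq_pow {κ : Type*} [Fintype κ] {s : κ → ℝ} {v B : ℝ} (hv : 0 < v)
    (hs : ∀ i, 0 ≤ s i) (hprod : ∏ i, s i = v ^ Fintype.card κ) (hle : ∀ i, s i ≤ B * v) (l : κ) :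
    v ≤ B ^ (Fintype.card κ - 1) * s l := by
  classical
  have others_le : ∏ i ∈ Finset.univ.erase l, s i ≤ (B * v) ^ (Fintype.card κ - 1) := by
    refine (Finset.prod_le_prod (fun i _ => hs i) fun i _ => hle i).trans_eq ?_
    rw [Finset.prod_const, Finset.card_erase_of_mem (Finset.mem_univ l), Finset.card_univ]
  refine le_of_mul_le_mul_right ?_ (pow_pos hv (Fintype.card κ - 1))
  calc v * v ^ (Fintype.card κ - 1) = s l * ∏ i ∈ Finset.univ.erase l, s i := by
        rw [← pow_succ', Nat.sub_add_cancel (Fintype.card_pos_iff.2 ⟨l⟩), ← hprod,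
          Finset.mul_prod_erase _ s (Finset.mem_univ l)]
    _ ≤ s l * (B * v) ^ (Fintype.card κ - 1) := mul_le_mul_of_nonneg_left others_le (hs l)
    _ = B ^ (Fintype.card κ - 1) * s l * v ^ (Fintype.card κ - 1) := by rw [mul_pow]; ring

variable {d : ℕ}

theorem side_le_of_dist_le {p q : Fin d → ℝ} (hpq : ∀ l, p l ≤ q l) {D : ℝ}
    (hD : ∀ x ∈ closedBox p q, ∀ y ∈ closedBox p q, dist x y ≤ D) (l : Fin d) :
    q l - p l ≤ D := by
  set x : Pt d := WithLp.toLp 2 (Function.update p l (q l)) with x_def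
  set y : Pt d := WithLp.toLp 2 p with y_def
  have x_mem : x ∈ closedBox p q := fun i => by
    by_cases hi : i = l
    · subst hi; simp [x_def, hpq i]
    · simp [x_def, hi, hpq i]
  have y_mem : y ∈ closedBox p q := fun i => ⟨le_rfl, hpq i⟩
  have coord_le : |q l - p l| ≤ dist x y := by
    simpa [dist_eq_norm, x_def, y_def] using PiLp.norm_apply_le (x - y) l
  exact (le_abs_self _).trans (coord_le.trans (hD x x_mem y y_mem))

theorem rpow_volume_closedBox_le_mul_side {p q : Fin d → ℝ} (hpq : ∀ l, p l ≤ q l)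
    (hV : 0 < volume.real (closedBox p q)) {T₀ : Set (Pt d)} {D : ℝ}
    (hD : ∀ x ∈ T₀, ∀ y ∈ T₀, dist x y ≤ D)
    (hT₀ : Metric.hausdorffEDist
      ((volume.real (closedBox p q) ^ (-(1 / (d : ℝ)))) • closedBox p q) T₀ < 1) (l : Fin d) :
    volume.real (closedBox p q) ^ (1 / (d : ℝ)) ≤ (D + 2) ^ (d - 1) * (q l - p l) := by
  set v := volume.real (closedBox p q) ^ (1 / (d : ℝ)) with v_def
  have v_pos : 0 < v := Real.rpow_pos_of_pos hV _
  have v_pow : v ^ d = volume.real (closedBox p q) := by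
    rw [v_def, one_div, Real.rpow_inv_natCast_pow hV.le (Fin.pos l).ne']
  rw [Real.rpow_neg hV.le, ← v_def, ← ENNReal.ofReal_one] at hT₀
  have dist_le : ∀ x ∈ closedBox p q, ∀ y ∈ closedBox p q, dist x y ≤ (D + 2) * v :=
    fun x hx y hy => by
      have scaled_le := dist_le_of_hausdorffEDist_lt hD hT₀
        (Set.smul_mem_smul_set (a := v⁻¹) hx) (Set.smul_mem_smul_set (a := v⁻¹) hy)
      rwa [dist_smul₀, Real.norm_of_nonneg (by positivity), inv_mul_le_iff₀ v_pos, mul_one,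
        mul_comm] at scaled_le
  simpa using le_pow_mul_of_prod_eq_pow v_pos (fun i => sub_nonneg.2 (hpq i))
    (by rw [Fintype.card_fin, v_pow, volume_real_closedBox hpq]) (side_le_of_dist_le hpq dist_le) l

variable {δ : ℕ → ℝ} {N : ℕ → Fin d → ℕ} {T : ℕ → Set (Pt d)}

theorem SamplingAssumption.eventually_region_eq (hS : SamplingAssumption δ T)
    (hT : (∀ n, T n = gridHull (δ n) (N n)) ∨ (∀ n, T n = gridBox (δ n) (N n))) :
    ∀ᶠ n in atTop, ∃ a, 0 ≤ a ∧ a ≤ δ n ∧ T n = closedBox (fun _ => a) (fun l => N n l * δ n) ∧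
      ∀ l, a ≤ N n l * δ n := by
  filter_upwards [hS.volume_tendsto.eventually_gt_atTop 0] with n volume_pos
  have hδ := hS.delta_pos n
  rcases hT with hT | hT
  · have one_le : ∀ l, 1 ≤ N n l := by
      by_contra hN
      rw [hT n, gridHull, gridPoints_eq_empty hN] at volume_pos
      simp [closedConvexHull_eq_closure_convexHull] at volume_pos
    exact ⟨δ n, hδ.le, le_rfl, (hT n).trans (gridHull_eq_closedBox hδ one_le),
      fun l => le_mul_of_one_le_left hδ.le (by exact_mod_cast one_le l)⟩
  · exact ⟨0, le_rfl, hδ.le, hT n, fun l => by positivity⟩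

theorem SamplingAssumption.eventually_bandwidth_le_side (hS : SamplingAssumption δ T)
    (hT : (∀ n, T n = gridHull (δ n) (N n)) ∨ (∀ n, T n = gridBox (δ n) (N n)))
    {Δ : ℕ → ℝ} (hΔT : Tendsto (fun n => Δ n ^ d / volume.real (T n)) atTop (𝓝 0)) (M : ℝ) :
    ∀ᶠ n in atTop, ∃ a, 0 ≤ a ∧ a ≤ δ n ∧ T n = closedBox (fun _ => a) (fun l => N n l * δ n) ∧
      ∀ l, M * Δ n ≤ N n l * δ n - a := by
  obtain ⟨T₀, T₀_bounded, -, -, shape_tendsto⟩ := hS.shape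
  obtain ⟨D, hD⟩ := Metric.isBounded_iff.1 T₀_bounded
  set B := (max D 0 + 2) ^ (d - 1)
  have B_pos : 0 < B := by positivity
  have ratio_tendsto : Tendsto (fun n => (B * M * Δ n) ^ d / volume.real (T n)) atTop (𝓝 0) := by
    simpa only [mul_pow, mul_div_assoc, mul_zero] using hΔT.const_mul ((B * M) ^ d)
  filter_upwards [hS.eventually_region_eq hT, hS.volume_tendsto.eventually_gt_atTop 0,
    shape_tendsto.eventually_lt_const one_pos, ratio_tendsto.eventually_lt_const one_pos]
    with n ⟨a, offset_nonneg, offset_le, region_eq, le_side⟩ volume_pos shape_lt ratio_lt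
  refine ⟨a, offset_nonneg, offset_le, region_eq, fun l => ?_⟩
  rw [div_lt_one volume_pos] at ratio_lt
  rw [region_eq] at volume_pos shape_lt ratio_lt
  have bandwidth_le : B * M * Δ n
      ≤ volume.real (closedBox (fun _ => a) fun l => N n l * δ n) ^ (1 / (d : ℝ)) := by
    refine (lt_of_pow_lt_pow_left₀ d (by positivity) ?_).le
    rwa [one_div, Real.rpow_inv_natCast_pow volume_pos.le (Fin.pos l).ne']
  refine le_of_mul_le_mul_left ?_ B_pos
  rw [← mul_assoc]
  exact bandwidth_le.trans (rpow_volume_closedBox_le_mul_side le_side volume_pos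
    (fun x hx y hy => (hD hx hy).trans (le_max_left D 0)) shape_lt l)

theorem SamplingAssumption.eventually_fineMesh (hS : SamplingAssumption δ T)
    (hT : (∀ n, T n = gridHull (δ n) (N n)) ∨ (∀ n, T n = gridBox (δ n) (N n)))
    {Δ : ℕ → ℝ} (hΔ : Tendsto Δ atTop atTop)
    (hΔT : Tendsto (fun n => Δ n ^ d / volume.real (T n)) atTop (𝓝 0)) {R : ℝ} (hR : 0 ≤ R) :
    ∀ᶠ n in atTop, ∃ a, FineMesh (R * Δ n) (δ n) a (N n) (T n) := by
  have diam_tendsto : Tendsto (fun n => √d * δ n) atTop (𝓝 0) := by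
    simpa using hS.delta_tendsto.const_mul (√d)
  filter_upwards [hS.eventually_bandwidth_le_side hT hΔT (2 * (R + 1)),
    hΔ.eventually_ge_atTop 1, diam_tendsto.eventually_lt_const one_pos,
    hS.delta_tendsto.eventually_lt_const one_pos]
    with n ⟨a, offset_nonneg, offset_le, region_eq, side_ge⟩ one_le_Δ diam_lt δ_lt
  exact ⟨a, by positivity, hS.delta_pos n, δ_lt.le, diam_lt, offset_nonneg, offset_le, region_eq,
    fun l => by linarith [side_ge l]⟩

end SamplingRegion

/-! ### Rates -/

section Rates

variable {d : ℕ} {H : Type*} [NormedAddCommGroup H] [InnerProductSpace ℂ H] [CompleteSpace H]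
  {ι Ω : Type*} [MeasurableSpace Ω] {P : Measure Ω} {e : HilbertBasis ι ℂ H}
  {X : Pt d → Ω → H} {K : Pt d → ℝ}

theorem CovAssumption.exists_lintegral_cellIdx_le {γ : ℝ} {C : Pt d → H →L[ℂ] H}
    (hC : CovAssumption e γ C) (hd : 1 ≤ d) : ∃ M : ℝ, 0 ≤ M ∧ ∀ δ : ℝ, 0 < δ → √d * δ < 1 →
      ∫⁻ x, traceNorm e (C (latticePt δ (cellIdx δ x)) - C x) ≤ ENNReal.ofReal (M * δ ^ γ) := by
  obtain ⟨M, hM⟩ := hC.holder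
  have : (0 : ℝ) < d := by exact_mod_cast hd
  refine ⟨max M 0 * √d ^ γ, by positivity, fun δ hδ diam_lt => ?_⟩
  calc ∫⁻ x, traceNorm e (C (latticePt δ (cellIdx δ x)) - C x)
      ≤ ∫⁻ x, ⨆ y ∈ Metric.closedBall x (√d * δ), traceNorm e (C y - C x) :=
        lintegral_mono fun x => le_iSup₂_of_le (latticePt δ (cellIdx δ x))
          (mem_closedBall_iff_norm.2 (norm_latticePt_cellIdx_sub_le hδ x)) le_rfl
    _ ≤ ENNReal.ofReal (M * (√d * δ) ^ γ) := hM _ (by positivity) diam_lt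
    _ ≤ ENNReal.ofReal (max M 0 * √d ^ γ * δ ^ γ) := by
        rw [mul_assoc, ← Real.mul_rpow (by positivity) hδ.le]
        gcongr
        exact le_max_left M 0

theorem FineMesh.bias_le_of_lintegral_le [Countable ι] {R δ a Δ : ℝ} {N : Fin d → ℕ}
    {T : Set (Pt d)} (hM : FineMesh (R * Δ) δ a N T) (hΔ : 1 ≤ Δ)
    (hX : IsStationaryRealProcess e P X) (hC : Integrable (covOp P X)) (hK : IsLagWindow K R)
    {A : NNReal} (hK_lip : LipschitzWith A K) {B β : ℝ} (hB : 0 ≤ B)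
    (hK_flat : ∀ x, |K x - 1| ≤ B * ‖x‖ ^ β) {θ : Pt d} {r : ℝ} (hθ : ‖θ‖ ≤ r)
    {γ M I J : ℝ} (hγ : γ ≤ 1) (hM_nonneg : 0 ≤ M) (hI : 0 ≤ I) (hJ : 0 ≤ J)
    (cell_le : ∫⁻ x, traceNorm e (covOp P X (latticePt δ (cellIdx δ x)) - covOp P X x)
      ≤ ENNReal.ofReal (M * δ ^ γ))
    (size_le : ∫⁻ x, traceNorm e (covOp P X x) ≤ ENNReal.ofReal I)
    (moment_le : ∫⁻ x, ENNReal.ofReal (‖x‖ ^ β) * hsNorm e (covOp P X x) ≤ ENNReal.ofReal J) :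
    hsNorm e ((∫ ω, specEstimator K X δ N T Δ θ ω ∂P) - spectralDensity P X θ)
      ≤ ENNReal.ofReal (((1 + 2 ^ d) * M + (2 ^ d + √d * r + A * √d) * I + B * J)
        * (δ ^ γ + Δ ^ (-β))) := by
  have hδ := hM.mesh_pos
  have hr : 0 ≤ r := (norm_nonneg θ).trans hθ
  have δ_le_rpow : δ ≤ δ ^ γ := Real.self_le_rpow_of_le_one hδ.le hM.mesh_le_one hγ
  have : 0 ≤ δ ^ γ := by positivity
  have Δβ_nonneg : 0 ≤ Δ ^ (-β) := by positivity
  calc hsNorm e ((∫ ω, specEstimator K X δ N T Δ θ ω ∂P) - spectralDensity P X θ)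
      ≤ ENNReal.ofReal (1 + 2 ^ d) * ENNReal.ofReal (M * δ ^ γ)
        + (ENNReal.ofReal ((2 ^ d + √d * r + A * √d) * δ) * ENNReal.ofReal I
        + ENNReal.ofReal (B * Δ ^ (-β)) * ENNReal.ofReal J) := by
        refine (hM.hsNorm_integral_specEstimator_sub_le hΔ hX hC hK hK_lip hB hK_flat hθ).trans ?_
        gcongr
        exacts [(lintegral_mono fun x => hsNorm_le_traceNorm e _).trans cell_le,
          (lintegral_mono fun x => hsNorm_le_traceNorm e _).trans size_le]
    _ = ENNReal.ofReal ((1 + 2 ^ d) * M * δ ^ γ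
        + ((2 ^ d + √d * r + A * √d) * I * δ + B * J * Δ ^ (-β))) := by
        rw [← ENNReal.ofReal_mul (by positivity), ← ENNReal.ofReal_mul (by positivity),
          ← ENNReal.ofReal_mul (by positivity), ← ENNReal.ofReal_add (by positivity)
          (by positivity), ← ENNReal.ofReal_add (by positivity) (by positivity)]
        congr 1
        ring
    _ ≤ ENNReal.ofReal ((1 + 2 ^ d) * M * (δ ^ γ + Δ ^ (-β))
        + ((2 ^ d + √d * r + A * √d) * I * (δ ^ γ + Δ ^ (-β))
          + B * J * (δ ^ γ + Δ ^ (-β)))) := by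
        gcongr <;> linarith
    _ = _ := by congr 1; ring

theorem exists_bias_le [Countable ι] (hd : 1 ≤ d) (hX : IsStationaryRealProcess e P X)
    {γ : ℝ} (hC : CovAssumption e γ (covOp P X)) {R : ℝ} (hK : IsLagWindow K R)
    {A : NNReal} (hK_lip : LipschitzWith A K)
    {β B L : ℝ} (hB : 0 ≤ B) (hK_flat : ∀ x, |K x - 1| ≤ B * ‖x‖ ^ β)
    (hf : spectralDensity P X ∈ powerLawClass e d β L)
    {Θ : Set (Pt d)} (hΘ : Bornology.IsBounded Θ) :
    ∃ c : ℝ, 0 ≤ c ∧ ∀ (δ Δ a : ℝ) (N : Fin d → ℕ) (T : Set (Pt d)), 1 ≤ Δ →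
      FineMesh (R * Δ) δ a N T → ∀ θ ∈ Θ,
      hsNorm e ((∫ ω, specEstimator K X δ N T Δ θ ω ∂P) - spectralDensity P X θ)
        ≤ ENNReal.ofReal (c * (δ ^ γ + Δ ^ (-β))) := by
  obtain ⟨M, M_nonneg, cell_le⟩ := hC.exists_lintegral_cellIdx_le hd
  obtain ⟨r, r_pos, hr⟩ := hΘ.exists_pos_norm_le
  have C_integrable := integrable_of_lintegral_traceNorm hC.measurable hC.integrable
  have moment_le : ∫⁻ x, ENNReal.ofReal (‖x‖ ^ β) * hsNorm e (covOp P X x)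
      ≤ ENNReal.ofReal (max L 0) :=
    (lintegral_rpow_norm_mul_hsNorm_le_of_mem_powerLawClass C_integrable hf).trans
      (ENNReal.ofReal_le_ofReal (le_max_left L 0))
  refine ⟨(1 + 2 ^ d) * M + (2 ^ d + √d * r + A * √d)
      * (∫⁻ x, traceNorm e (covOp P X x)).toReal + B * max L 0, by positivity,
    fun δ Δ a N T one_le_Δ hmesh θ hθ => ?_⟩
  exact hmesh.bias_le_of_lintegral_le one_le_Δ hX C_integrable hK hK_lip hB hK_flat (hr θ hθ)
    hC.gamma_le_one M_nonneg ENNReal.toReal_nonneg (le_max_right L 0)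
    (cell_le δ hmesh.mesh_pos hmesh.diam_cell_lt_one)
    (ENNReal.ofReal_toReal hC.integrable.ne).ge moment_le

theorem exists_variance_le [IsProbabilityMeasure P] [Countable ι] (hd : 1 ≤ d)
    (hX : IsStationaryRealProcess e P X) {γ : ℝ} (hC : CovAssumption e γ (covOp P X))
    (hV : CumulantAssumption e P X) {R : ℝ} (hK : IsLagWindow K R) :
    ∃ c ε : ℝ, 0 ≤ c ∧ 0 < ε ∧ ∀ (δ Δ a : ℝ) (N : Fin d → ℕ) (T : Set (Pt d)), 1 ≤ Δ →
      FineMesh (R * Δ) δ a N T → √d * δ < ε → ∀ θ,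
      ∫⁻ ω, hsNorm e (specEstimator K X δ N T Δ θ ω
          - ∫ ω, specEstimator K X δ N T Δ θ ω ∂P) ^ 2 ∂P
        ≤ ENNReal.ofReal (c * (Δ ^ d / volume.real T)) := by
  obtain ⟨M, M_nonneg, cell_le⟩ := hC.exists_lintegral_cellIdx_le hd
  obtain ⟨ε, hε, mass_lt⟩ := hV.cum_integrable
  change cumulantMass e P X ε < ∞ at mass_lt
  have weak_lt : ∫⁻ x, weakTraceNorm e (covOp P X x) < ∞ :=
    (lintegral_mono fun x => weakTraceNorm_le_traceNorm e _).trans_lt hC.integrable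
  obtain ⟨Q, hQ⟩ : ∃ Q : NNReal, (Q : ℝ≥0∞) = volume (Metric.closedBall (0 : Pt d) 1) *
      (cumulantMass e P X ε
        + 2 * ((∫⁻ x, weakTraceNorm e (covOp P X x)) + ENNReal.ofReal M) ^ 2) :=
    ⟨_, ENNReal.coe_toNNReal (by finiteness [mass_lt.ne, weak_lt.ne,
      (measure_closedBall_lt_top (μ := volume) (x := (0 : Pt d)) (r := 1)).ne])⟩
  have hR := hK.radius_nonneg
  refine ⟨2 ^ (3 * d) * (R + 1) ^ d * Q, ε, by positivity, hε,
    fun δ Δ a N T one_le_Δ hmesh hδε θ => ?_⟩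
  have hδ := hmesh.mesh_pos
  have hT := hmesh.volume_pos
  have cell_le_const : ∫⁻ x, traceNorm e (covOp P X (latticePt δ (cellIdx δ x)) - covOp P X x)
      ≤ ENNReal.ofReal M :=
    (cell_le δ hδ hmesh.diam_cell_lt_one).trans (ENNReal.ofReal_le_ofReal
      (mul_le_of_le_one_right M_nonneg (Real.rpow_le_one hδ.le hmesh.mesh_le_one hC.gamma_pos.le)))
  calc ∫⁻ ω, hsNorm e (specEstimator K X δ N T Δ θ ω
          - ∫ ω, specEstimator K X δ N T Δ θ ω ∂P) ^ 2 ∂P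
      ≤ ENNReal.ofReal (2 ^ (3 * d) * (R + 1) ^ d * (Δ ^ d / volume.real T)) * Q := by
        refine (hmesh.lintegral_hsNorm_sq_specEstimator_sub_le one_le_Δ hX hC.measurable hV hδε hK
          θ).trans ?_
        rw [hQ]
        gcongr
    _ = _ := by
        rw [← ENNReal.ofReal_coe_nnreal, ← ENNReal.ofReal_mul (by positivity)]
        congr 1
        ring

theorem aestronglyMeasurable_specEstimator {δ : ℝ} (hδ : 0 < δ)
    (hX : ∀ t, AEStronglyMeasurable (X t) P) (N : Fin d → ℕ) (T : Set (Pt d)) (Δ : ℝ)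
    (θ : Pt d) : AEStronglyMeasurable (specEstimator K X δ N T Δ θ) P := by
  have dyad_measurable : ∀ s t : Pt d, AEStronglyMeasurable (β := H →L[ℂ] H)
      (fun ω => InnerProductSpace.rankOne ℂ (X s ω) (X t ω)) P :=
    fun s t => aestronglyMeasurable_rankOne (hX s) (hX t)
  rw [funext (specEstimator_eq_sum hδ N T Δ θ)]
  exact Finset.aestronglyMeasurable_fun_sum _ fun p _ => (dyad_measurable _ _).fun_const_smul _

theorem lintegral_hsNorm_sub_sq_rpow_le [IsProbabilityMeasure P] [Countable ι]
    {F : Ω → H →L[ℂ] H} (hF : AEStronglyMeasurable F P) (A B : H →L[ℂ] H) :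
    (∫⁻ ω, hsNorm e (F ω - A) ^ 2 ∂P) ^ (1 / 2 : ℝ)
      ≤ (∫⁻ ω, hsNorm e (F ω - B) ^ 2 ∂P) ^ (1 / 2 : ℝ) + hsNorm e (B - A) := by
  have centred_measurable : AEMeasurable (fun ω => hsNorm e (F ω - B)) P :=
    aemeasurable_hsNorm e (hF.sub aestronglyMeasurable_const)
  have minkowski := ENNReal.lintegral_Lp_add_le centred_measurable
    (aemeasurable_const (b := hsNorm e (B - A))) one_le_two
  simp only [Pi.add_apply, ENNReal.rpow_two, lintegral_const, measure_univ, mul_one] at minkowski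
  rw [← ENNReal.rpow_two, ← ENNReal.rpow_mul, mul_one_div_cancel two_ne_zero,
    ENNReal.rpow_one] at minkowski
  refine le_trans ?_ minkowski
  gcongr with ω
  simpa using hsNorm_add_le e (F ω - B) (B - A)

theorem rmse_le_of_variance_le_of_bias_le [IsProbabilityMeasure P] [Countable ι]
    {F : Ω → H →L[ℂ] H} (hF : AEStronglyMeasurable F P) {A B : H →L[ℂ] H} {cv cb x y : ℝ}
    (hcv : 0 ≤ cv) (hcb : 0 ≤ cb) (hy : 0 ≤ y)
    (variance_le : ∫⁻ ω, hsNorm e (F ω - B) ^ 2 ∂P ≤ ENNReal.ofReal (cv * y ^ 2))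
    (bias_le : hsNorm e (B - A) ≤ ENNReal.ofReal (cb * (x + y))) :
    (∫⁻ ω, hsNorm e (F ω - A) ^ 2 ∂P) ^ (1 / 2 : ℝ)
      ≤ ENNReal.ofReal ((√cv + 2 * cb) * max x y) := by
  calc (∫⁻ ω, hsNorm e (F ω - A) ^ 2 ∂P) ^ (1 / 2 : ℝ)
      ≤ ENNReal.ofReal (cv * y ^ 2) ^ (1 / 2 : ℝ) + ENNReal.ofReal (cb * (x + y)) :=
        (lintegral_hsNorm_sub_sq_rpow_le hF A B).trans (by gcongr)
    _ = ENNReal.ofReal (√cv * y) + ENNReal.ofReal (cb * (x + y)) := by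
        rw [ENNReal.ofReal_rpow_of_nonneg (by positivity) (by norm_num), ← Real.sqrt_eq_rpow,
          Real.sqrt_mul hcv, Real.sqrt_sq hy]
    _ ≤ ENNReal.ofReal (√cv * max x y) + ENNReal.ofReal (cb * (max x y + max x y)) := by
        gcongr
        exacts [le_max_right x y, le_max_left x y, le_max_right x y]
    _ = ENNReal.ofReal ((√cv + 2 * cb) * max x y) := by
        have : 0 ≤ max x y := hy.trans (le_max_right x y)
        rw [← ENNReal.ofReal_add (by positivity) (by positivity)]
        congr 1
        ring

theorem optimal_bandwidth_pow_div {β V : ℝ} (hβ : 0 < β) (hV : 0 < V) :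
    (V ^ (1 / (2 * β + (d : ℝ)))) ^ d / V = (V ^ (-β / (2 * β + (d : ℝ)))) ^ 2 := by
  rw [← Real.rpow_natCast, ← Real.rpow_natCast, ← Real.rpow_mul hV.le, ← Real.rpow_mul hV.le,
    ← Real.rpow_sub_one hV.ne']
  congr 1
  have : 0 < 2 * β + (d : ℝ) := by positivity
  push_cast
  field_simp
  ring

theorem optimal_bandwidth_rpow_neg {β V : ℝ} (hV : 0 ≤ V) :
    (V ^ (1 / (2 * β + (d : ℝ)))) ^ (-β) = V ^ (-β / (2 * β + (d : ℝ))) := by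
  rw [← Real.rpow_mul hV]
  congr 1
  ring

theorem tendsto_optimal_bandwidth_pow_div {β : ℝ} (hβ : 0 < β) {V : ℕ → ℝ}
    (hV : Tendsto V atTop atTop) :
    Tendsto (fun n => (V n ^ (1 / (2 * β + (d : ℝ)))) ^ d / V n) atTop (𝓝 0) := by
  have rate_tendsto : Tendsto (fun n => (V n ^ (-(β / (2 * β + (d : ℝ))))) ^ 2) atTop (𝓝 0) := by
    simpa using ((tendsto_rpow_neg_atTop (y := β / (2 * β + (d : ℝ)))
      (by positivity)).comp hV).pow 2
  refine rate_tendsto.congr' ?_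
  filter_upwards [hV.eventually_gt_atTop 0] with n hVn
  rw [optimal_bandwidth_pow_div hβ hVn, neg_div]

end Rates

theorem mainTheorem8_general
    {H : Type*} [NormedAddCommGroup H] [InnerProductSpace ℂ H] [CompleteSpace H]
    [TopologicalSpace.SeparableSpace H]
    {ι : Type*} (e : HilbertBasis ι ℂ H)
    {Ω : Type*} [MeasurableSpace Ω] (P : Measure Ω) [IsProbabilityMeasure P]
    {d : ℕ} (hd : 1 ≤ d)
    (X : Pt d → Ω → H) (hX : IsStationaryRealProcess e P X)
    (γ : ℝ) (hC : CovAssumption e γ (covOp P X))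
    (hV : CumulantAssumption e P X)
    (K : Pt d → ℝ) (hK : KernelAssumption K)
    (δ : ℕ → ℝ) (N : ℕ → Fin d → ℕ) (T : ℕ → Set (Pt d))
    (hT : (∀ n, T n = gridHull (δ n) (N n)) ∨ (∀ n, T n = gridBox (δ n) (N n)))
    (hS : SamplingAssumption δ T)
    (β L : ℝ) (hβ : 0 < β)
    (hf : spectralDensity P X ∈ powerLawClass e d β L)
    (lam : ℕ) (hlamβ : β - 1 < (lam : ℝ)) (hflat : KernelFlat K lam)
    (Θ : Set (Pt d)) (hΘ : Bornology.IsBounded Θ) :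
    (∀ Δ : ℕ → ℝ, Tendsto Δ atTop atTop →
      Tendsto (fun n => Δ n ^ d / volume.real (T n)) atTop (𝓝 0) →
      ∃ c : ℝ, ∀ᶠ n in atTop, ∀ θ ∈ Θ,
        hsNorm e ((∫ ω, specEstimator K X (δ n) (N n) (T n) (Δ n) θ ω ∂P)
            - spectralDensity P X θ)
          ≤ ENNReal.ofReal (c * (δ n ^ γ + Δ n ^ (-β)))) ∧
    (∃ c : ℝ, ∀ᶠ n in atTop, ∀ θ ∈ Θ,
      (∫⁻ ω, hsNorm e (specEstimator K X (δ n) (N n) (T n)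
          (volume.real (T n) ^ (1 / (2 * β + (d : ℝ)))) θ ω - spectralDensity P X θ) ^ 2 ∂P)
            ^ (1 / 2 : ℝ)
        ≤ ENNReal.ofReal
            (c * max (δ n ^ γ) (volume.real (T n) ^ (-β / (2 * β + (d : ℝ)))))) := by
  have : Countable ι := countable_of_hilbertBasis e
  obtain ⟨R, hR⟩ := hK.exists_isLagWindow
  obtain ⟨A, hK_lip⟩ := hflat.exists_lipschitzWith hK
  obtain ⟨B, hB, hK_flat⟩ := hflat.exists_abs_sub_one_le_rpow hK hβ hlamβ
  obtain ⟨cb, hcb, bias_le⟩ := exists_bias_le hd hX hC hR hK_lip hB hK_flat hf hΘ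
  obtain ⟨cv, ε, hcv, hε, variance_le⟩ := exists_variance_le hd hX hC hV hR
  refine ⟨fun Δ hΔ hΔT => ⟨cb, ?_⟩, √cv + 2 * cb, ?_⟩
  · filter_upwards [hΔ.eventually_ge_atTop 1, hS.eventually_fineMesh hT hΔ hΔT hR.radius_nonneg]
      with n one_le_Δ ⟨a, hmesh⟩
    exact bias_le _ _ a _ _ one_le_Δ hmesh
  · have hΔ := (tendsto_rpow_atTop (y := 1 / (2 * β + d)) (by positivity)).comp hS.volume_tendsto
    have hΔT := tendsto_optimal_bandwidth_pow_div (d := d) hβ hS.volume_tendsto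
    have diam_tendsto := hS.delta_tendsto.const_mul (√d)
    rw [mul_zero] at diam_tendsto
    filter_upwards [hΔ.eventually_ge_atTop 1, hS.eventually_fineMesh hT hΔ hΔT hR.radius_nonneg,
      diam_tendsto.eventually_lt_const hε] with n one_le_Δ ⟨a, hmesh⟩ diam_lt θ hθ
    have variance := variance_le _ _ a _ _ one_le_Δ hmesh diam_lt θ
    have bias := bias_le _ _ a _ _ one_le_Δ hmesh θ hθ
    rw [Function.comp_apply, optimal_bandwidth_pow_div hβ hmesh.volume_pos] at variance
    rw [Function.comp_apply, optimal_bandwidth_rpow_neg hmesh.volume_pos.le] at bias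
    exact rmse_le_of_variance_le_of_bias_le (aestronglyMeasurable_specEstimator hmesh.mesh_pos
      (fun t => (hX.memLp_two t).1) _ _ _ θ) hcv hcb (by positivity) variance bias

theorem mainTheorem8
    {H : Type*} [NormedAddCommGroup H] [InnerProductSpace ℂ H] [CompleteSpace H]
    [TopologicalSpace.SeparableSpace H]
    {ι : Type*} (e : HilbertBasis ι ℂ H)
    {Ω : Type*} [MeasurableSpace Ω] (P : Measure Ω) [IsProbabilityMeasure P]
    {d : ℕ} (hd : 1 ≤ d)
    (X : Pt d → Ω → H) (hX : IsStationaryRealProcess e P X)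
    (γ : ℝ) (hC : CovAssumption e γ (covOp P X))
    (hV : CumulantAssumption e P X)
    (K : Pt d → ℝ) (hK : KernelAssumption K)
    (δ : ℕ → ℝ) (N : ℕ → Fin d → ℕ) (T : ℕ → Set (Pt d))
    (hT : (∀ n, T n = gridHull (δ n) (N n)) ∨ (∀ n, T n = gridBox (δ n) (N n)))
    (hS : SamplingAssumption δ T)
    (β L : ℝ) (hβ : 0 < β) (hL : 0 < L)
    (hf : spectralDensity P X ∈ powerLawClass e d β L)
    (lam : ℕ) (hlam : 0 < lam) (hlamβ : β - 1 < (lam : ℝ)) (hflat : KernelFlat K lam)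
    (Θ : Set (Pt d)) (hΘ : Bornology.IsBounded Θ) :
    -- the bias bound
    (∀ Δ : ℕ → ℝ, Tendsto Δ atTop atTop →
      (∀ᶠ n in atTop, Δ n • kernelSupport K ⊆ T n - T n) →
      Tendsto (fun n => Δ n ^ d / volume.real (T n)) atTop (𝓝 0) →
      ∃ c : ℝ, ∀ᶠ n in atTop, ∀ θ ∈ Θ,
        hsNorm e ((∫ ω, specEstimator K X (δ n) (N n) (T n) (Δ n) θ ω ∂P)
            - spectralDensity P X θ)
          ≤ ENNReal.ofReal (c * (δ n ^ γ + Δ n ^ (-β)))) ∧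
    -- the root mean squared error bound with the rate-optimal bandwidth
    (∃ c : ℝ, ∀ᶠ n in atTop, ∀ θ ∈ Θ,
      (∫⁻ ω, hsNorm e (specEstimator K X (δ n) (N n) (T n)
          (volume.real (T n) ^ (1 / (2 * β + (d : ℝ)))) θ ω - spectralDensity P X θ) ^ 2 ∂P)
            ^ (1 / 2 : ℝ)
        ≤ ENNReal.ofReal
            (c * max (δ n ^ γ) (volume.real (T n) ^ (-β / (2 * β + (d : ℝ)))))) := by
  obtain ⟨bias_bound, rmse_bound⟩ := mainTheorem8_general e P hd X hX γ hC hV K hK δ N T hT hS β L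
    hβ hf lam hlamβ hflat Θ hΘ
  exact ⟨fun Δ hΔ _ => bias_bound Δ hΔ, rmse_bound⟩
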